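/- Let $(M^n,g)$ be a smooth Hausdorff Riemannian manifold with an almost contact metric structure $(\phi,\xi,\eta,g)$, i.e. a smooth $(1,1)$-tensor field $\phi$, vector field $\xi$ and $1$-form $\eta$ with $\phi^2=-I+\eta\otimes\xi$, $\eta(\xi)=1$, $\eta\circ\phi=0$, $\phi\xi=0$, $g(\phi X,\phi Y)=g(X,Y)-\eta(X)\eta(Y)$, $g(X,\phi Y)=-g(\phi X,Y)$ and $g(X,\xi)=\eta(X)$. Let $\alpha\in\mathbb R$ and suppose that $M$ is $\alpha$-cosymplectic: $d\eta=0$, $d\Phi=2\alpha\,\eta\wedge\Phi$ for $\Phi(X,Y)=g(\phi X,Y)$, and $[\phi X,\phi Y]-\phi[\phi X,Y]-\phi[X,\phi Y]+\phi^2[X,Y]+2d\eta(X,Y)\xi=0$ for all smooth vector fields $X,Y$. Let $\nabla$ be the Levi-Civita connection, with scalar curvature $r$, and let $\tilde\nabla$ be the quarter-symmetric metric connection, i.e. the metric connection with torsion $T(X,Y)=\eta(Y)\phi X-\eta(X)\phi Y$. For $\tilde\nabla$ put $\tilde R(X,Y)Z=\tilde\nabla_X\tilde\nabla_YZ-\tilde\nabla_Y\tilde\nabla_XZ-\tilde\nabla_{[X,Y]}Z$,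 $\tilde S(Y,Z)=\operatorname{tr}(X\mapsto\tilde R(X,Y)Z)$, $\tilde r=\operatorname{tr}_g\tilde S$, $\tilde S^*(X,Y)=\frac12\operatorname{tr}(Z\mapsto\tilde R(X,\phi Y)\phi Z)$, $\tilde r^*=\operatorname{tr}_g\tilde S^*$ and $(\tilde{\mathcal L}_\xi g)(X,Y)=g(\tilde\nabla_X\xi,Y)+g(X,\tilde\nabla_Y\xi)$. Suppose that, for real constants $\Lambda,\mu,\rho,q$, the manifold admits a $*$-$\eta$-Ricci-Yamabe soliton with respect to $\tilde\nabla$, in at least one of the following two senses: (a) $\tilde{\mathcal L}_\xi g+2\rho\tilde S^*+[2\Lambda-q\tilde r^*]\,g+2\mu\,\eta\otimes\eta=0$; (b) the same equation with $\tilde S+\alpha^2(n-2)g+\alpha^2\eta\otimes\eta$ in place of $\tilde S^*$ and $\tilde r+\alpha^2(n-1)^2$ in place of $\tilde r^*$, that is, $\tilde{\mathcal L}_\xi g+2\rho\tilde S+[2\Lambda+2\alpha^2\rho(n-2)-q\tilde r-q\alpha^2(n-1)^2]\,g+[2\mu+2\alpha^2\rho]\,\eta\otimes\eta=0$. If $\xi=\operatorname{grad}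 f$ for a smooth function $f$ on $M$, then, with $\Delta f=\operatorname{div}(\operatorname{grad} f)$, $$\Delta f=-n\Big[\Lambda+\alpha^2\rho(n-2)-\frac{qr}{2}-\frac{q\alpha^2(n-1)^2}{2}\Big]-\mu-\rho(\alpha^2+r).$$ -/

import Mathlib

open Bundle
open scoped Manifold ContDiff

namespace CosymplecticSoliton

noncomputable section

section Tangent

variable {n : ℕ} {M : Type*} [TopologicalSpace M] [ChartedSpace (EuclideanSpace ℝ (Fin n)) M]

instance finiteDimensional_tangentSpace (x : M) : FiniteDimensional ℝ (TangentSpace (𝓡 n) x) :=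
  inferInstanceAs (FiniteDimensional ℝ (EuclideanSpace ℝ (Fin n)))

/-- A (not necessarily smooth) vector field on `M`. -/
abbrev VField (n : ℕ) (M : Type*) [TopologicalSpace M]
    [ChartedSpace (EuclideanSpace ℝ (Fin n)) M] : Type _ :=
  (x : M) → TangentSpace (𝓡 n) x

/-- An affine connection on `M`. In Mathlib's argument order, `D Y x (X x)` is `(∇_X Y)(x)`. -/
abbrev Connection (n : ℕ) (M : Type*) [TopologicalSpace M]
    [ChartedSpace (EuclideanSpace ℝ (Fin n)) M] [IsManifold (𝓡 n) ∞ M] : Type _ :=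
  CovariantDerivative (𝓡 n) (EuclideanSpace ℝ (Fin n)) (TangentSpace (𝓡 n) : M → Type _)

variable [IsManifold (𝓡 n) ∞ M]

/-- Smooth vector fields. -/
def SmoothVField (X : VField n M) : Prop :=
  ContMDiff (𝓡 n) ((𝓡 n).prod 𝓘(ℝ, EuclideanSpace ℝ (Fin n))) ∞
    (fun x ↦ (⟨x, X x⟩ : TotalSpace (EuclideanSpace ℝ (Fin n)) (TangentSpace (𝓡 n) : M → Type _)))

/-- The derivative `X h` of a function `h` along a vector field `X`. -/
def dirDeriv (X : VField n M) (h : M → ℝ) (x : M) : ℝ := mvfderiv (𝓡 n) h x (X x)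

/-- The Lie bracket `[X, Y]`. -/
def bracket (X Y : VField n M) : VField n M := VectorField.mlieBracket (𝓡 n) X Y

/-- The exterior derivative of a 1-form, evaluated on vector fields and normalized as
`X(θ(Y)) - Y(θ(X)) - θ([X, Y])`. -/
def extDerivOne (θ : (x : M) → TangentSpace (𝓡 n) x →L[ℝ] ℝ) (X Y : VField n M) (x : M) : ℝ :=
  dirDeriv X (fun y ↦ θ y (Y y)) x - dirDeriv Y (fun y ↦ θ y (X y)) x - θ x (bracket X Y x)

/-- The exterior derivative of a 2-form, evaluated on vector fields and normalized as the cyclic sum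
of `X(Ω(Y, Z)) - Ω([X, Y], Z)`. -/
def extDerivTwo (Ω : (x : M) → TangentSpace (𝓡 n) x → TangentSpace (𝓡 n) x → ℝ)
    (X Y Z : VField n M) (x : M) : ℝ :=
  dirDeriv X (fun y ↦ Ω y (Y y) (Z y)) x + dirDeriv Y (fun y ↦ Ω y (Z y) (X y)) x
    + dirDeriv Z (fun y ↦ Ω y (X y) (Y y)) x
    - Ω x (bracket X Y x) (Z x) - Ω x (bracket Y Z x) (X x) - Ω x (bracket Z X x) (Y x)

/-- The wedge product of a 1-form and a 2-form on three vectors, in the normalization that matches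
`extDerivTwo` (the identity `dΩ = c θ ∧ Ω` does not depend on which of the two usual conventions is
used for both `d` and `∧`). -/
def wedgeOneTwo (θ : (x : M) → TangentSpace (𝓡 n) x →L[ℝ] ℝ)
    (Ω : (x : M) → TangentSpace (𝓡 n) x → TangentSpace (𝓡 n) x → ℝ)
    (x : M) (u v w : TangentSpace (𝓡 n) x) : ℝ :=
  θ x u * Ω x v w + θ x v * Ω x w u + θ x w * Ω x u v

/-- The curvature operator on vector fields,
`R(X, Y)Z = ∇_X ∇_Y Z - ∇_Y ∇_X Z - ∇_{[X, Y]} Z`. -/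
def curvatureField (D : Connection n M) (X Y Z : VField n M) : VField n M := fun x ↦
  D (fun y ↦ D Z y (Y y)) x (X x) - D (fun y ↦ D Z y (X y)) x (Y x) - D Z x (bracket X Y x)

/-- The curvature tensor `R(u, v)w` at a point, computed with vector fields that extend `u`, `v`,
`w` smoothly near that point (for a smooth connection the choice of extensions is irrelevant). -/
def curvature (D : Connection n M) (x : M) (u v w : TangentSpace (𝓡 n) x) :
    TangentSpace (𝓡 n) x :=
  curvatureField D (FiberBundle.extend (EuclideanSpace ℝ (Fin n)) u)
    (FiberBundle.extend (EuclideanSpace ℝ (Fin n)) v)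
    (FiberBundle.extend (EuclideanSpace ℝ (Fin n)) w) x

/-- The divergence of `X` with respect to `D`: the trace of `v ↦ ∇_v X`. -/
def divergence (D : Connection n M) (X : VField n M) (x : M) : ℝ :=
  LinearMap.trace ℝ (TangentSpace (𝓡 n) x) (D X x).toLinearMap

end Tangent

section Riemannian

variable {n : ℕ} {M : Type*} [TopologicalSpace M] [ChartedSpace (EuclideanSpace ℝ (Fin n)) M]
  [RiemannianBundle (fun x : M ↦ TangentSpace (𝓡 n) x)]

/-- The trace, with respect to the metric, of a bilinear form on the tangent space at `x`. -/
def metricTrace (x : M) (B : TangentSpace (𝓡 n) x → TangentSpace (𝓡 n) x → ℝ) : ℝ :=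
  ∑ i, B (stdOrthonormalBasis ℝ (TangentSpace (𝓡 n) x) i)
    (stdOrthonormalBasis ℝ (TangentSpace (𝓡 n) x) i)

/-- The gradient of `f`: the vector field with `⟨grad f, v⟩ = df(v)`. -/
def gradient (f : M → ℝ) : VField n M := fun x ↦
  ∑ i, mvfderiv (𝓡 n) f x (stdOrthonormalBasis ℝ (TangentSpace (𝓡 n) x) i) •
    stdOrthonormalBasis ℝ (TangentSpace (𝓡 n) x) i

theorem inner_gradient (f : M → ℝ) (x : M) (v : TangentSpace (𝓡 n) x) :
    inner ℝ (gradient f x) v = mvfderiv (𝓡 n) f x v := by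
  conv_rhs => rw [← (stdOrthonormalBasis ℝ (TangentSpace (𝓡 n) x)).sum_repr' v]
  simp only [gradient, sum_inner, inner_smul_left, map_sum, map_smul, smul_eq_mul]
  exact Finset.sum_congr rfl fun i _ ↦ mul_comm _ _

variable [IsManifold (𝓡 n) ∞ M]

/-- The Ricci tensor `S(v, w) = trace (u ↦ R(u, v)w)` of a connection. -/
def ricci (D : Connection n M) (x : M) (v w : TangentSpace (𝓡 n) x) : ℝ :=
  metricTrace x (fun e e' ↦ inner ℝ (curvature D x e v w) e')

/-- The scalar curvature of a connection: the metric trace of its Ricci tensor. -/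
def scalarCurvature (D : Connection n M) (x : M) : ℝ := metricTrace x (ricci D x)

/-- The Laplacian `Δ f = div (grad f)` (with respect to `D`, the Levi-Civita connection). -/
def laplacian (D : Connection n M) (f : M → ℝ) (x : M) : ℝ := divergence D (gradient f) x

/-- `(𝓛_V g)(u, v) = g(∇_u V, v) + g(u, ∇_v V)`, the Lie derivative of the metric along `V` with
respect to the connection `D`. -/
def lieMetric (D : Connection n M) (V : VField n M) (x : M) (u v : TangentSpace (𝓡 n) x) : ℝ :=
  inner ℝ (D V x u) v + inner ℝ u (D V x v)

variable (n M) in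
/-- An almost contact metric structure `(φ, ξ, η, g)` on `M`, where `g` is the Riemannian metric
of `M`. -/
structure AlmostContactMetric where
  φ : (x : M) → TangentSpace (𝓡 n) x →L[ℝ] TangentSpace (𝓡 n) x
  ξ : VField n M
  η : (x : M) → TangentSpace (𝓡 n) x →L[ℝ] ℝ
  smooth_φ : ContMDiff (𝓡 n)
    ((𝓡 n).prod 𝓘(ℝ, EuclideanSpace ℝ (Fin n) →L[ℝ] EuclideanSpace ℝ (Fin n))) ∞
    (fun x ↦ (⟨x, φ x⟩ : TotalSpace (EuclideanSpace ℝ (Fin n) →L[ℝ] EuclideanSpace ℝ (Fin n))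
      (fun x : M ↦ TangentSpace (𝓡 n) x →L[ℝ] TangentSpace (𝓡 n) x)))
  smooth_ξ : SmoothVField ξ
  /-- Smoothness of the 1-form; also a consequence of `smooth_ξ` and `inner_ξ`. -/
  smooth_η : ContMDiff (𝓡 n) ((𝓡 n).prod 𝓘(ℝ, EuclideanSpace ℝ (Fin n) →L[ℝ] ℝ)) ∞
    (fun x ↦ TotalSpace.mk' (EuclideanSpace ℝ (Fin n) →L[ℝ] ℝ)
      (E := fun x : M ↦ TangentSpace (𝓡 n) x →L[ℝ] Bundle.Trivial M ℝ x) x (η x))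
  φ_φ : ∀ x v, φ x (φ x v) = -v + η x v • ξ x
  η_ξ : ∀ x, η x (ξ x) = 1
  η_φ : ∀ x v, η x (φ x v) = 0
  φ_ξ : ∀ x, φ x (ξ x) = 0
  inner_φ_φ : ∀ x u v, (inner ℝ (φ x u) (φ x v) : ℝ) = inner ℝ u v - η x u * η x v
  inner_φ : ∀ x u v, (inner ℝ u (φ x v) : ℝ) = -inner ℝ (φ x u) v
  inner_ξ : ∀ x v, (inner ℝ v (ξ x) : ℝ) = η x v

namespace AlmostContactMetric

variable (A : AlmostContactMetric n M)

/-- The fundamental 2-form `Φ(u, v) = g(φ u, v)`. -/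
def fundForm (x : M) (u v : TangentSpace (𝓡 n) x) : ℝ := inner ℝ (A.φ x u) v

/-- The vector field `φ X`. -/
def φField (X : VField n M) : VField n M := fun x ↦ A.φ x (X x)

/-- The normality tensor `[φX, φY] - φ[φX, Y] - φ[X, φY] + φ²[X, Y] + 2 dη(X, Y) ξ`, with
`2 dη(X, Y) = X(η(Y)) - Y(η(X)) - η([X, Y])`. -/
def nijenhuis (X Y : VField n M) : VField n M := fun x ↦
  bracket (A.φField X) (A.φField Y) x - A.φ x (bracket (A.φField X) Y x)
    - A.φ x (bracket X (A.φField Y) x) + A.φ x (A.φ x (bracket X Y x))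
    + extDerivOne A.η X Y x • A.ξ x

/-- The structure is `α`-cosymplectic: `dη = 0`, `dΦ = 2α η ∧ Φ`, and it is normal. -/
structure IsCosymplectic (α : ℝ) : Prop where
  closed : ∀ X Y : VField n M, SmoothVField X → SmoothVField Y →
    ∀ x, extDerivOne A.η X Y x = 0
  dΦ : ∀ X Y Z : VField n M, SmoothVField X → SmoothVField Y → SmoothVField Z →
    ∀ x, extDerivTwo A.fundForm X Y Z x =
      2 * α * wedgeOneTwo A.η A.fundForm x (X x) (Y x) (Z x)
  normal : ∀ X Y : VField n M, SmoothVField X → SmoothVField Y →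
    ∀ x, A.nijenhuis X Y x = 0

/-- The `*`-Ricci tensor `S*(u, v) = (1/2) trace (w ↦ R(u, φ v) φ w)` of a connection. -/
def starRicci (D : Connection n M) (x : M) (u v : TangentSpace (𝓡 n) x) : ℝ :=
  (1 / 2) * metricTrace x (fun e e' ↦ inner ℝ (curvature D x u (A.φ x v) (A.φ x e)) e')

/-- The `*`-scalar curvature: the metric trace of the `*`-Ricci tensor. -/
def starScalar (D : Connection n M) (x : M) : ℝ := metricTrace x (A.starRicci D x)

/-- The `*`-`η`-Ricci-Yamabe soliton equation with respect to a connection: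
`𝓛_ξ g + 2ρ S* + (2Λ - q r*) g + 2μ η ⊗ η = 0`. -/
def IsStarSoliton (D : Connection n M) (Λ μ ρ q : ℝ) : Prop :=
  ∀ (x : M) (u v : TangentSpace (𝓡 n) x),
    lieMetric D A.ξ x u v + 2 * ρ * A.starRicci D x u v
      + (2 * Λ - q * A.starScalar D x) * inner ℝ u v + 2 * μ * (A.η x u * A.η x v) = 0

/-- The soliton equation with respect to a connection written through its Ricci tensor `S` and
scalar curvature `r`: the `*`-Ricci tensor is taken to be `S + α²(n-2) g + α² η ⊗ η`, and the
`*`-scalar curvature to be `r + α²(n-1)²`. -/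
def IsRicciFormSoliton (D : Connection n M) (α Λ μ ρ q : ℝ) : Prop :=
  ∀ (x : M) (u v : TangentSpace (𝓡 n) x),
    lieMetric D A.ξ x u v + 2 * ρ * ricci D x u v
      + (2 * Λ + 2 * α ^ 2 * ρ * ((n : ℝ) - 2) - q * scalarCurvature D x
          - q * α ^ 2 * ((n : ℝ) - 1) ^ 2) * inner ℝ u v
      + (2 * μ + 2 * α ^ 2 * ρ) * (A.η x u * A.η x v) = 0

end AlmostContactMetric

variable [IsContMDiffRiemannianBundle (𝓡 n) ∞ (EuclideanSpace ℝ (Fin n))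
  (fun x : M ↦ TangentSpace (𝓡 n) x)]

instance riemannian_one : IsContMDiffRiemannianBundle (𝓡 n) 1 (EuclideanSpace ℝ (Fin n))
    (fun x : M ↦ TangentSpace (𝓡 n) x) :=
  IsContMDiffRiemannianBundle.of_le (n := ∞) (by norm_cast)

/-- The Levi-Civita connection: smooth, torsion-free and metric. -/
structure IsLeviCivita (D : Connection n M) : Prop where
  smooth : D.ContMDiffCovariantDerivative ∞
  torsion_free : ∀ (x : M) (u v : TangentSpace (𝓡 n) x), D.torsion x u v = 0
  metric : D.IsMetricCompatible

/-- The quarter-symmetric metric connection of an almost contact metric structure: smooth, metric,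
with torsion `T(X, Y) = η(Y) φX - η(X) φY`. -/
structure IsQuarterSymmetricMetric (A : AlmostContactMetric n M) (D : Connection n M) : Prop where
  smooth : D.ContMDiffCovariantDerivative ∞
  torsion_eq : ∀ (x : M) (u v : TangentSpace (𝓡 n) x),
    D.torsion x u v = A.η x v • A.φ x u - A.η x u • A.φ x v
  metric : D.IsMetricCompatible

end Riemannian

end

end CosymplecticSoliton

/-!
Tracing either soliton equation with respect to `g` gives `2 Δf` from the Lie derivative term, since
`ξ = grad f`, plus multiples of the scalar (or `*`-scalar) curvature of `∇̃`. The formula follows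
because `∇̃ξ = ∇ξ`, `r̃ = r` and `r̃* = r + α² (n - 1)²`.

The structure equation of an `α`-cosymplectic manifold,
`(∇_X φ)Y = α (g(φX, Y) ξ - η(Y) φX)` (`IsCosymplectic.derivφ_eq`), is derived from `dη = 0`,
`dΦ = 2α η ∧ Φ` and normality; with `Y = ξ` it yields `∇_X ξ = α (X - η(X) ξ)`. Differentiating both
once more gives `R(X, Y)ξ` and the commutator of `R(X, Y)` with `φ`
(`IsCosymplectic.curvatureField_ξ`, `IsCosymplectic.curvatureField_φField`). By the first Bianchi
identity and pair symmetry `S*(u, v) = ∑ g(R(eᵢ, u)φv, φeᵢ)`, and the commutator turns this into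
`S* = S + α² (n - 2) g + α² η ⊗ η` (`IsCosymplectic.starRicci_eq`).

The quarter-symmetric metric connection is `∇̃_X Y = ∇_X Y - η(X) φY`
(`IsQuarterSymmetricMetric.nabla_eq`), so its curvature is that of `∇` plus
`η(X) (∇_Y φ)Z - η(Y) (∇_X φ)Z`. The extra terms do not contribute to `S̃*`, and add the skew form
`α g(φu, v)` to the Ricci tensor.

All computations take place with globally smooth vector fields, because smoothness of a connection
and the cosymplectic conditions are stated for those; on a Hausdorff manifold every tangent vector
extends to one. `curvature` is reduced to such fields through locality, and through tensoriality,
which for a metric connection is a consequence of the skew-adjointness of `R(X, Y)`.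
-/

namespace CosymplecticSoliton

noncomputable section

open Filter Topology

/-! ### Globally smooth vector fields -/

section Fields

variable {n : ℕ} {M : Type*} [TopologicalSpace M] [ChartedSpace (EuclideanSpace ℝ (Fin n)) M]
  [IsManifold (𝓡 n) ∞ M]

theorem isManifold_minSmoothness_two : IsManifold (𝓡 n) (minSmoothness ℝ 2) M := by
  rw [minSmoothness_of_isRCLikeNormedField]; infer_instance

theorem isManifold_minSmoothness_three : IsManifold (𝓡 n) (minSmoothness ℝ 3) M := by
  rw [minSmoothness_of_isRCLikeNormedField]; infer_instance

/-- Differentiability of a vector field at a point. -/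
def DiffVFieldAt (X : VField n M) (x : M) : Prop :=
  MDifferentiableAt (𝓡 n) ((𝓡 n).prod 𝓘(ℝ, EuclideanSpace ℝ (Fin n)))
    (fun x ↦ (⟨x, X x⟩ : TotalSpace (EuclideanSpace ℝ (Fin n)) (TangentSpace (𝓡 n) : M → Type _)))
    x

/-- The local extension of a tangent vector that enters the definition of `curvature`. -/
def extField {x : M} (v : TangentSpace (𝓡 n) x) : VField n M :=
  FiberBundle.extend (E := (TangentSpace (𝓡 n) : M → Type _)) (EuclideanSpace ℝ (Fin n)) v

theorem extField_apply_self {x : M} (v : TangentSpace (𝓡 n) x) : extField v x = v :=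
  FiberBundle.extend_apply_self (E := (TangentSpace (𝓡 n) : M → Type _)) _ v

/-- The vector field `∇_X Z`. -/
def nabla (D : Connection n M) (X Z : VField n M) : VField n M := fun y ↦ D Z y (X y)

namespace SmoothVField

variable {X Y Z : VField n M}

theorem mdifferentiableAt (hX : SmoothVField X) (x : M) : DiffVFieldAt X x :=
  (ContMDiff.contMDiffAt hX).mdifferentiableAt (by simp)

theorem const_smul (c : ℝ) (hX : SmoothVField X) : SmoothVField (c • X) :=
  ContMDiff.const_smul_section hX

theorem smul {h : M → ℝ} (hh : ContMDiff (𝓡 n) 𝓘(ℝ, ℝ) ∞ h) (hX : SmoothVField X) :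
    SmoothVField (h • X) :=
  ContMDiff.smul_section hh hX

theorem bracket (hX : SmoothVField X) (hY : SmoothVField Y) : SmoothVField (bracket X Y) := by
  have := isManifold_minSmoothness_two (n := n) (M := M)
  have : IsManifold (𝓡 n) (((⊤ : ℕ∞) : ℕ∞ω) + 1) M := ‹IsManifold (𝓡 n) ∞ M›
  refine ContDiff.mlieBracket_vectorField (n := ⊤) (m := ⊤) hX hY ?_
  rw [minSmoothness_of_isRCLikeNormedField]
  exact le_rfl

theorem nabla {D : Connection n M} (hD : D.ContMDiffCovariantDerivative ∞)
    (hX : SmoothVField X) (hZ : SmoothVField Z) : SmoothVField (nabla D X Z) := by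
  have h := hD.contMDiff.contMDiff (σ := Z) (by simpa using ContMDiff.contMDiffOn hZ)
  exact ContMDiff.clm_bundle_apply (contMDiffOn_univ.1 h) hX

end SmoothVField

/-- On a Hausdorff manifold every tangent vector extends to a globally smooth vector field, namely
the local extension `FiberBundle.extend` cut off by a bump function. -/
theorem exists_smoothVField_eventuallyEq_extend [T2Space M] (x : M) (v : TangentSpace (𝓡 n) x) :
    ∃ X : VField n M, SmoothVField X ∧
      X =ᶠ[𝓝 x] extField v := by
  obtain ⟨s, hs, hsv⟩ := FiberBundle.exists_contMDiffOn_extend (k := ∞) (𝓡 n)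
    (EuclideanSpace ℝ (Fin n)) (V := (TangentSpace (𝓡 n) : M → Type _)) v
  obtain ⟨t, hts, ht, hxt⟩ := mem_nhds_iff.1 hs
  obtain ⟨ψ, -, hψ⟩ := (SmoothBumpFunction.nhds_basis_tsupport (I := 𝓡 n) x).mem_iff.1
    (ht.mem_nhds hxt)
  refine ⟨(ψ : M → ℝ) • extField v,
    ContMDiffOn.smul_section_of_tsupport ψ.contMDiff.contMDiffOn ht hψ (hsv.mono hts), ?_⟩
  filter_upwards [ψ.eventuallyEq_one] with y hy
  simp [hy]; rfl

theorem exists_smoothVField_apply_eq [T2Space M] (x : M) (v : TangentSpace (𝓡 n) x) :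
    ∃ X : VField n M, SmoothVField X ∧ X x = v := by
  obtain ⟨X, hX, h⟩ := exists_smoothVField_eventuallyEq_extend x v
  exact ⟨X, hX, by rw [h.eq_of_nhds, extField_apply_self]⟩

theorem eventually_mdifferentiableAt_extend (x : M) (v : TangentSpace (𝓡 n) x) :
    ∀ᶠ y in 𝓝 x, DiffVFieldAt (extField v) y := by
  obtain ⟨s, hs, hsv⟩ := FiberBundle.exists_mdifferentiableOn_extend (𝓡 n)
    (EuclideanSpace ℝ (Fin n)) (V := (TangentSpace (𝓡 n) : M → Type _)) v
  filter_upwards [eventually_mem_nhds_iff.2 hs] with y hy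
  exact (hsv y (mem_of_mem_nhds hy)).mdifferentiableAt hy

/-- Vector fields act on functions by derivations whose commutator is the Lie bracket. The identity
is read off from the Jacobi identity for `X`, `Y` and `h • W`, where `W` is any smooth vector field
not vanishing at the point. -/
theorem dirDeriv_bracket {X Y W : VField n M} (hX : SmoothVField X) (hY : SmoothVField Y)
    (hW : SmoothVField W) {h : M → ℝ} (hh : ContMDiff (𝓡 n) 𝓘(ℝ, ℝ) ∞ h)
    (hXh : ContMDiff (𝓡 n) 𝓘(ℝ, ℝ) ∞ (dirDeriv X h))
    (hYh : ContMDiff (𝓡 n) 𝓘(ℝ, ℝ) ∞ (dirDeriv Y h)) {x : M} (hWx : W x ≠ 0) :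
    dirDeriv (bracket X Y) h x = dirDeriv X (dirDeriv Y h) x - dirDeriv Y (dirDeriv X h) x := by
  have := isManifold_minSmoothness_two (n := n) (M := M)
  have := isManifold_minSmoothness_three (n := n) (M := M)
  have two : (minSmoothness ℝ 2) ≤ (∞ : ℕ∞ω) := by
    rw [minSmoothness_of_isRCLikeNormedField]; norm_cast
  have J {U : VField n M} (hU : SmoothVField U) :=
    VectorField.leibniz_identity_mlieBracket_apply (I := 𝓡 n) (x := x)
    (ContMDiff.contMDiffAt hX |>.of_le two) (ContMDiff.contMDiffAt hY |>.of_le two)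
    (ContMDiff.contMDiffAt hU |>.of_le two)
  change ∀ {U : VField n M}, SmoothVField U → bracket X (bracket Y U) x =
    bracket (bracket X Y) U x + bracket Y (bracket X U) x at J
  have md {h : M → ℝ} (hh : ContMDiff (𝓡 n) 𝓘(ℝ, ℝ) ∞ h) (y : M) :
      MDifferentiableAt (𝓡 n) 𝓘(ℝ, ℝ) h y :=
    hh.contMDiffAt.mdifferentiableAt (by simp)
  have B {U : VField n M} {k : M → ℝ} {V : VField n M} (hk : ContMDiff (𝓡 n) 𝓘(ℝ, ℝ) ∞ k)
      (hV : SmoothVField V) : bracket U (k • V) =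
        dirDeriv U k • V + k • bracket U V := by
    ext1 y
    exact VectorField.mlieBracket_smul_right (md hk y) (hV.mdifferentiableAt y)
  have A {U V V' : VField n M} (hV : SmoothVField V) (hV' : SmoothVField V') :
      bracket U (V + V') x = bracket U V x
        + bracket U V' x :=
    VectorField.mlieBracket_add_right (hV.mdifferentiableAt x) (hV'.mdifferentiableAt x)
  have J1 := J hW
  have J2 := J (hW.smul hh)
  rw [B hh hW, B hh hW, B hh hW, A (hW.smul hYh) ((hY.bracket hW).smul hh),
    A (hW.smul hXh) ((hX.bracket hW).smul hh), B hYh hW, B hXh hW, B hh (hY.bracket hW),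
    B hh (hX.bracket hW)] at J2
  simp only [Pi.add_apply, Pi.smul_apply'] at J2
  have key : (dirDeriv X (dirDeriv Y h) x - dirDeriv Y (dirDeriv X h) x
      - dirDeriv (bracket X Y) h x) • W x = 0 := by
    linear_combination (norm := module) J2 - h x • J1
  rw [smul_eq_zero, or_iff_left hWx] at key
  linarith

/-- The curvature tensor may be computed from globally smooth vector fields that agree with
`FiberBundle.extend` near the point. -/
theorem curvature_eq_curvatureField_of_eventuallyEq {D : Connection n M}
    (hD : D.ContMDiffCovariantDerivative ∞) {X Y Z : VField n M} (hX : SmoothVField X)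
    (hY : SmoothVField Y) (hZ : SmoothVField Z) {x : M} {u v w : TangentSpace (𝓡 n) x}
    (hXu : X =ᶠ[𝓝 x] extField u)
    (hYv : Y =ᶠ[𝓝 x] extField v)
    (hZw : Z =ᶠ[𝓝 x] extField w) :
    curvature D x u v w = curvatureField D X Y Z x := by
  have hDZ : ∀ᶠ y in 𝓝 x, D (extField w) y = D Z y := by
    filter_upwards [hZw.eventuallyEq_nhds, eventually_mdifferentiableAt_extend x w] with y hy hwy
    exact D.isCovariantDerivativeOn.congr_of_eventuallyEq hwy (hZ.mdifferentiableAt y) univ_mem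
      hy.symm
  have aux {V : VField n M} (hV : SmoothVField V) {a : TangentSpace (𝓡 n) x}
      (h : V =ᶠ[𝓝 x] extField a) :
      D (fun y ↦ D (extField w) y
        (extField a y)) x = D (fun y ↦ D Z y (V y)) x := by
    have hs := (hV.nabla hD hZ).mdifferentiableAt x
    have he : ∀ᶠ y in 𝓝 x, (fun y ↦ D (extField w) y
        (extField a y)) y = (fun y ↦ D Z y (V y)) y := by
      filter_upwards [hDZ, h] with y h1 h2
      simp only [h1, h2]
    refine D.isCovariantDerivativeOn.congr_of_eventuallyEq ?_ hs univ_mem he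
    refine hs.congr_of_eventuallyEq ?_
    filter_upwards [he] with y hy
    rw [hy]; rfl
  change D (fun y ↦ D (extField w) y (extField v y)) x (extField u x)
    - D (fun y ↦ D (extField w) y (extField u y)) x (extField v x)
    - D (extField w) x (VectorField.mlieBracket (𝓡 n) (extField u) (extField v) x) = _
  rw [aux hX hXu, aux hY hYv, hDZ.self_of_nhds,
    ← (hXu.mlieBracket_vectorField_eq hYv), ← hXu.eq_of_nhds, ← hYv.eq_of_nhds]
  rfl

end Fields

/-! ### Curvature of metric connections -/

section Fields

variable {n : ℕ} {M : Type*} [TopologicalSpace M] [ChartedSpace (EuclideanSpace ℝ (Fin n)) M]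

theorem bracket_swap (X Y : VField n M) : bracket X Y = -bracket Y X :=
  VectorField.mlieBracket_swap

theorem dirDeriv_const (X : VField n M) (c : ℝ) (x : M) : dirDeriv X (fun _ ↦ c) x = 0 := by
  unfold dirDeriv
  rw [mvfderiv_const]; rfl

variable [IsManifold (𝓡 n) ∞ M] {D : Connection n M} {X Y Z W : VField n M}

theorem curvatureField_eq (D : Connection n M) (X Y Z : VField n M) :
    curvatureField D X Y Z = nabla D X (nabla D Y Z) - nabla D Y (nabla D X Z)
      - nabla D (bracket X Y) Z := rfl

theorem curvatureField_swap (D : Connection n M) (X Y Z : VField n M) (x : M) :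
    curvatureField D X Y Z x = -curvatureField D Y X Z x := by
  simp only [curvatureField, bracket_swap X Y, Pi.neg_apply, map_neg]
  module

theorem nabla_add (D : Connection n M) (X : VField n M) (hY : SmoothVField Y)
    (hZ : SmoothVField Z) : nabla D X (Y + Z) = nabla D X Y + nabla D X Z := by
  ext1 x
  have h := D.isCovariantDerivativeOnUniv.add (hY.mdifferentiableAt x) (hZ.mdifferentiableAt x)
  exact congrArg (fun T ↦ T (X x)) h

theorem nabla_smul (D : Connection n M) (X : VField n M) {h : M → ℝ}
    (hh : ContMDiff (𝓡 n) 𝓘(ℝ, ℝ) ∞ h) (hZ : SmoothVField Z) :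
    nabla D X (h • Z) = dirDeriv X h • Z + h • nabla D X Z := by
  ext1 x
  have h := D.isCovariantDerivativeOnUniv.leibniz (hZ.mdifferentiableAt x)
    (hh.contMDiffAt.mdifferentiableAt (by simp))
  rw [add_comm]
  exact congrArg (fun T ↦ T (X x)) h

theorem nabla_const_smul (D : Connection n M) (X : VField n M) (c : ℝ) (hZ : SmoothVField Z) :
    nabla D X (c • Z) = c • nabla D X Z := by
  ext1 x
  have h := D.isCovariantDerivativeOnUniv.smul_const c (hZ.mdifferentiableAt x)
  exact congrArg (fun T ↦ T (X x)) h

theorem nabla_sub (D : Connection n M) (X : VField n M) (hY : SmoothVField Y)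
    (hZ : SmoothVField Z) : nabla D X (Y - Z) = nabla D X Y - nabla D X Z := by
  have h := nabla_add D X hY (hZ.const_smul (-1))
  rw [nabla_const_smul D X _ hZ] at h
  simpa [sub_eq_add_neg] using h

theorem SmoothVField.sub (hX : SmoothVField X) (hY : SmoothVField Y) : SmoothVField (X - Y) :=
  ContMDiff.sub_section hX hY

end Fields

section Riemannian

variable {n : ℕ} {M : Type*} [TopologicalSpace M] [ChartedSpace (EuclideanSpace ℝ (Fin n)) M]
  [RiemannianBundle (fun x : M ↦ TangentSpace (𝓡 n) x)] [IsManifold (𝓡 n) ∞ M]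
  {D : Connection n M} {X Y Z W : VField n M}
  [IsContMDiffRiemannianBundle (𝓡 n) ∞ (EuclideanSpace ℝ (Fin n))
  (fun x : M ↦ TangentSpace (𝓡 n) x)]

theorem SmoothVField.inner (hX : SmoothVField X) (hY : SmoothVField Y) :
    ContMDiff (𝓡 n) 𝓘(ℝ, ℝ) ∞ (fun y ↦ (inner ℝ (X y) (Y y) : ℝ)) :=
  ContMDiff.inner_bundle hX hY

/-- Compatibility with the metric for globally smooth fields. -/
theorem dirDeriv_inner (hm : D.IsMetricCompatible) (X : VField n M) (hY : SmoothVField Y)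
    (hZ : SmoothVField Z) (x : M) :
    dirDeriv X (fun y ↦ (inner ℝ (Y y) (Z y) : ℝ)) x =
      inner ℝ (nabla D X Y x) (Z x) + inner ℝ (Y x) (nabla D X Z x) :=
  hm.mvfderiv_inner_eq X (hY.mdifferentiableAt x) (hZ.mdifferentiableAt x)

/-- `R(X, Y)` is skew-adjoint for a metric connection: apply the commutator formula for `X`, `Y` to
the function `g(Z, W)`. -/
theorem inner_curvatureField_skew (hD : D.ContMDiffCovariantDerivative ∞)
    (hm : D.IsMetricCompatible) (hX : SmoothVField X) (hY : SmoothVField Y)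
    (hZ : SmoothVField Z) (hW : SmoothVField W) (x : M) :
    (inner ℝ (curvatureField D X Y Z x) (W x) : ℝ) =
      -inner ℝ (Z x) (curvatureField D X Y W x) := by
  have key {U V V' : VField n M} (hU : SmoothVField U) (hV : SmoothVField V)
      (hV' : SmoothVField V') : ContMDiff (𝓡 n) 𝓘(ℝ, ℝ) ∞
        (dirDeriv U (fun y ↦ (inner ℝ (V y) (V' y) : ℝ))) := by
    simp only [funext (dirDeriv_inner hm U hV hV')]
    exact ((hU.nabla hD hV).inner hV').add (hV.inner (hU.nabla hD hV'))
  have second {U U' : VField n M} (hU : SmoothVField U) (hU' : SmoothVField U') :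
      dirDeriv U (dirDeriv U' (fun y ↦ (inner ℝ (Z y) (W y) : ℝ))) x =
        inner ℝ (nabla D U (nabla D U' Z) x) (W x) + inner ℝ (nabla D U' Z x) (nabla D U W x)
        + (inner ℝ (nabla D U Z x) (nabla D U' W x)
          + inner ℝ (Z x) (nabla D U (nabla D U' W) x)) := by
    have h1 := hU'.nabla hD hZ
    have h2 := hU'.nabla hD hW
    rw [← dirDeriv_inner hm U h1 hW, ← dirDeriv_inner hm U hZ h2,
      funext (dirDeriv_inner hm U' hZ hW)]
    unfold dirDeriv
    have := mvfderiv_fun_add (I := 𝓡 n) (x := x)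
      ((h1.inner hW).contMDiffAt.mdifferentiableAt (by simp))
      ((hZ.inner h2).contMDiffAt.mdifferentiableAt (by simp))
    exact congrArg (fun T ↦ T (U x)) this
  have comm (hne : Z x ≠ 0 ∨ W x ≠ 0) :
      dirDeriv (bracket X Y) (fun y ↦ (inner ℝ (Z y) (W y) : ℝ)) x =
        dirDeriv X (dirDeriv Y (fun y ↦ (inner ℝ (Z y) (W y) : ℝ))) x
          - dirDeriv Y (dirDeriv X (fun y ↦ (inner ℝ (Z y) (W y) : ℝ))) x := by
    rcases hne with h | h
    · exact dirDeriv_bracket hX hY hZ (hZ.inner hW) (key hX hZ hW) (key hY hZ hW) h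
    · exact dirDeriv_bracket hX hY hW (hZ.inner hW) (key hX hZ hW) (key hY hZ hW) h
  -- Where both `Z` and `W` vanish, the identity is `0 = 0`; elsewhere one of them can serve as the
  -- nonvanishing field that the commutator formula requires.
  by_cases hne : Z x ≠ 0 ∨ W x ≠ 0
  · have h := comm hne
    rw [second hX hY, second hY hX, dirDeriv_inner hm _ hZ hW] at h
    simp only [curvatureField_eq, Pi.sub_apply, inner_sub_left, inner_sub_right]
    linarith
  · push Not at hne
    simp [hne.1, hne.2]

/-- The curvature operator of a metric connection is tensorial in its last argument, because its
metric adjoint is, up to sign, the curvature operator itself. -/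
theorem curvatureField_congr_right [T2Space M] (hD : D.ContMDiffCovariantDerivative ∞)
    (hm : D.IsMetricCompatible) (hX : SmoothVField X) (hY : SmoothVField Y)
    (hZ : SmoothVField Z) (hW : SmoothVField W) {x : M} (h : Z x = W x) :
    curvatureField D X Y Z x = curvatureField D X Y W x := by
  refine ext_inner_right ℝ fun v ↦ ?_
  obtain ⟨V, hV, rfl⟩ := exists_smoothVField_apply_eq x v
  rw [inner_curvatureField_skew hD hm hX hY hZ hV, inner_curvatureField_skew hD hm hX hY hW hV, h]

namespace IsLeviCivita

theorem nabla_sub_nabla (h : IsLeviCivita D) (hX : SmoothVField X) (hY : SmoothVField Y) :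
    nabla D X Y - nabla D Y X = bracket X Y := by
  ext1 x
  have h1 := D.torsion_apply (hX.mdifferentiableAt x) (hY.mdifferentiableAt x)
  rw [h.torsion_free] at h1
  exact (sub_eq_zero.1 h1.symm)

theorem bianchi (h : IsLeviCivita D) (hX : SmoothVField X) (hY : SmoothVField Y)
    (hZ : SmoothVField Z) (x : M) :
    curvatureField D X Y Z x + curvatureField D Y Z X x + curvatureField D Z X Y x = 0 := by
  have key {X Y Z : VField n M} (hX : SmoothVField X) (hY : SmoothVField Y)
      (hZ : SmoothVField Z) :
      nabla D X (nabla D Y Z) x - nabla D X (nabla D Z Y) x - nabla D (bracket Y Z) X x =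
        bracket X (bracket Y Z) x := by
    rw [← h.nabla_sub_nabla hX (hY.bracket hZ), ← h.nabla_sub_nabla hY hZ,
      nabla_sub D X (hY.nabla h.smooth hZ) (hZ.nabla h.smooth hY)]
    rfl
  have := isManifold_minSmoothness_two (n := n) (M := M)
  have := isManifold_minSmoothness_three (n := n) (M := M)
  have two : (minSmoothness ℝ 2) ≤ (∞ : ℕ∞ω) := by
    rw [minSmoothness_of_isRCLikeNormedField]; norm_cast
  have J : bracket X (bracket Y Z) x = bracket (bracket X Y) Z x + bracket Y (bracket X Z) x :=
    VectorField.leibniz_identity_mlieBracket_apply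
    (ContMDiff.contMDiffAt hX |>.of_le two) (ContMDiff.contMDiffAt hY |>.of_le two)
    (ContMDiff.contMDiffAt hZ |>.of_le two)
  have neg_right (U V : VField n M) (hV : SmoothVField V) : bracket U (-V) x = -bracket U V x := by
    have := VectorField.mlieBracket_const_smul_right (I := 𝓡 n) (V := U) (c := (-1 : ℝ))
      (hV.mdifferentiableAt x)
    simpa [bracket] using this
  have J' : bracket X (bracket Y Z) x + bracket Y (bracket Z X) x + bracket Z (bracket X Y) x
      = 0 := by
    rw [J, bracket_swap (bracket X Y) Z, bracket_swap Z X, neg_right Y _ (hX.bracket hZ)]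
    simp only [Pi.neg_apply]
    module
  simp only [curvatureField_eq, Pi.sub_apply]
  rw [← key hX hY hZ, ← key hY hZ hX, ← key hZ hX hY] at J'
  linear_combination (norm := module) J'

/-- Pair symmetry of the Riemann tensor. -/
theorem inner_curvatureField_pair (h : IsLeviCivita D) (hX : SmoothVField X) (hY : SmoothVField Y)
    (hZ : SmoothVField Z) (hW : SmoothVField W) (x : M) :
    (inner ℝ (curvatureField D X Y Z x) (W x) : ℝ) = inner ℝ (curvatureField D Z W X x) (Y x) := by
  have B {X Y Z W : VField n M} (hX : SmoothVField X) (hY : SmoothVField Y)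
      (hZ : SmoothVField Z) : (inner ℝ (curvatureField D X Y Z x) (W x) : ℝ)
        + inner ℝ (curvatureField D Y Z X x) (W x) + inner ℝ (curvatureField D Z X Y x) (W x)
        = 0 := by
    rw [← inner_add_left, ← inner_add_left, h.bianchi hX hY hZ, inner_zero_left]
  have S {X Y Z W : VField n M} (hX : SmoothVField X) (hY : SmoothVField Y)
      (hZ : SmoothVField Z) (hW : SmoothVField W) :
      (inner ℝ (curvatureField D X Y Z x) (W x) : ℝ) =
        -inner ℝ (curvatureField D X Y W x) (Z x) := by
    rw [inner_curvatureField_skew h.smooth h.metric hX hY hZ hW, real_inner_comm]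
  have A (X Y Z W : VField n M) : (inner ℝ (curvatureField D X Y Z x) (W x) : ℝ) =
      -inner ℝ (curvatureField D Y X Z x) (W x) := by
    rw [curvatureField_swap, inner_neg_left]
  linarith [B (W := W) hX hY hZ, B (W := X) hY hZ hW, B (W := Y) hZ hW hX, B (W := Z) hW hX hY,
    S hX hY hZ hW, S hY hZ hX hW, S hZ hX hY hW, S hY hZ hW hX, S hZ hW hY hX, S hW hY hZ hX,
    S hZ hW hX hY, S hW hX hZ hY, S hX hZ hW hY, S hW hX hY hZ, S hX hY hW hZ, S hY hW hX hZ,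
    A X Z W Y, A W Y Z X, A Z X Y W, A Z X W Y, A Y W X Z, A Y W Z X]

end IsLeviCivita

end Riemannian

/-! ### The structure tensors of an `α`-cosymplectic manifold -/

section Cosymplectic

variable {n : ℕ} {M : Type*} [TopologicalSpace M] [ChartedSpace (EuclideanSpace ℝ (Fin n)) M]
  [RiemannianBundle (fun x : M ↦ TangentSpace (𝓡 n) x)] [IsManifold (𝓡 n) ∞ M]
  {D : Connection n M} {X Y Z W : VField n M}

namespace AlmostContactMetric

variable (A : AlmostContactMetric n M)

theorem smooth_φField (hX : SmoothVField X) : SmoothVField (A.φField X) :=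
  ContMDiff.clm_bundle_apply A.smooth_φ hX

theorem φField_apply (X : VField n M) (x : M) : A.φField X x = A.φ x (X x) := rfl

theorem inner_φ_left (x : M) (u v : TangentSpace (𝓡 n) x) :
    (inner ℝ (A.φ x u) v : ℝ) = -inner ℝ u (A.φ x v) := by
  rw [A.inner_φ, neg_neg]

theorem inner_φ_self (x : M) (v : TangentSpace (𝓡 n) x) : (inner ℝ (A.φ x v) v : ℝ) = 0 := by
  have := A.inner_φ x v v
  rw [real_inner_comm (A.φ x v) v] at this
  linarith

theorem inner_ξ_left (x : M) (v : TangentSpace (𝓡 n) x) : (inner ℝ (A.ξ x) v : ℝ) = A.η x v := by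
  rw [real_inner_comm, A.inner_ξ]

/-- The covariant derivative of the structure tensor, `(∇_X φ)Y = ∇_X(φY) - φ(∇_X Y)`. -/
def derivφ (D : Connection n M) (X Y : VField n M) : VField n M :=
  nabla D X (A.φField Y) - A.φField (nabla D X Y)

theorem derivφ_apply (D : Connection n M) (X Y : VField n M) (x : M) :
    A.derivφ D X Y x = nabla D X (A.φField Y) x - A.φ x (nabla D X Y x) := rfl

/-- The vector field `α (g(φX, Y) ξ - η(Y) φX)`, which is `(∇_X φ)Y` on an `α`-cosymplectic
manifold. -/
def modelDerivφ (α : ℝ) (X Y : VField n M) : VField n M := fun x ↦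
  α • ((inner ℝ (A.φ x (X x)) (Y x) : ℝ) • A.ξ x - A.η x (Y x) • A.φ x (X x))

theorem IsCosymplectic.η_bracket {A : AlmostContactMetric n M} {α : ℝ}
    (hA : A.IsCosymplectic α) (hX : SmoothVField X) (hY : SmoothVField Y) (x : M) :
    A.η x (bracket X Y x) =
      dirDeriv X (fun y ↦ A.η y (Y y)) x - dirDeriv Y (fun y ↦ A.η y (X y)) x := by
  have := hA.closed X Y hX hY x
  rw [extDerivOne] at this
  linarith

variable [IsContMDiffRiemannianBundle (𝓡 n) ∞ (EuclideanSpace ℝ (Fin n))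
  (fun x : M ↦ TangentSpace (𝓡 n) x)]

variable {A} {α : ℝ}

theorem smooth_η_apply (hX : SmoothVField X) :
    ContMDiff (𝓡 n) 𝓘(ℝ, ℝ) ∞ (fun y ↦ A.η y (X y)) := by
  simp only [← A.inner_ξ]
  exact hX.inner A.smooth_ξ

theorem dirDeriv_η (hm : D.IsMetricCompatible) (X : VField n M) (hY : SmoothVField Y) (x : M) :
    dirDeriv X (fun y ↦ A.η y (Y y)) x =
      A.η x (nabla D X Y x) + inner ℝ (Y x) (nabla D X A.ξ x) := by
  simp only [← A.inner_ξ]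
  exact dirDeriv_inner hm X hY A.smooth_ξ x

theorem η_nabla_ξ (hm : D.IsMetricCompatible) (X : VField n M) (x : M) :
    A.η x (nabla D X A.ξ x) = 0 := by
  have h := dirDeriv_η (A := A) hm X A.smooth_ξ x
  simp only [A.η_ξ, dirDeriv_const, A.inner_ξ_left] at h
  linarith

/-- `∇ξ` is symmetric because `η` is closed. -/
theorem IsCosymplectic.inner_nabla_ξ_comm (hA : A.IsCosymplectic α) (hD : IsLeviCivita D)
    (hX : SmoothVField X) (hY : SmoothVField Y) (x : M) :
    (inner ℝ (nabla D X A.ξ x) (Y x) : ℝ) = inner ℝ (nabla D Y A.ξ x) (X x) := by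
  have h := hA.closed X Y hX hY x
  rw [extDerivOne, dirDeriv_η hD.metric X hY, dirDeriv_η hD.metric Y hX,
    ← hD.nabla_sub_nabla hX hY, Pi.sub_apply, map_sub] at h
  rw [real_inner_comm, real_inner_comm (X x)]
  linarith

theorem inner_derivφ_skew (hm : D.IsMetricCompatible) (X : VField n M) (hY : SmoothVField Y)
    (hZ : SmoothVField Z) (x : M) :
    (inner ℝ (A.derivφ D X Y x) (Z x) : ℝ) = -inner ℝ (A.derivφ D X Z x) (Y x) := by
  have h1 := dirDeriv_inner hm X (A.smooth_φField hY) hZ x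
  have h2 := dirDeriv_inner hm X hY (A.smooth_φField hZ) x
  have h3 : dirDeriv X (fun y ↦ (inner ℝ (A.φField Y y) (Z y) : ℝ)) x =
      -dirDeriv X (fun y ↦ (inner ℝ (Y y) (A.φField Z y) : ℝ)) x := by
    simp only [φField_apply, inner_φ_left]
    unfold dirDeriv
    rw [mvfderiv_fun_neg]; rfl
  simp only [derivφ_apply, inner_sub_left, φField_apply, inner_φ_left] at *
  rw [real_inner_comm (Y x), real_inner_comm (A.φ x (Y x)), inner_φ_left] at *
  linarith

/-- Differentiating `φ² = -1 + η ⊗ ξ`. -/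
theorem derivφ_φField (hm : D.IsMetricCompatible) (X : VField n M) (hY : SmoothVField Y) (x : M) :
    A.derivφ D X (A.φField Y) x + A.φ x (A.derivφ D X Y x) =
      (inner ℝ (Y x) (nabla D X A.ξ x) : ℝ) • A.ξ x + A.η x (Y x) • nabla D X A.ξ x := by
  have h : A.φField (A.φField Y) = (-1 : ℝ) • Y + (fun y ↦ A.η y (Y y)) • A.ξ := by
    ext1 y
    simp [φField_apply, A.φ_φ]
  have hη := smooth_η_apply (A := A) hY
  rw [derivφ_apply, derivφ_apply, h, nabla_add D X (hY.const_smul _) (A.smooth_ξ.smul hη),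
    nabla_const_smul D X _ hY, nabla_smul D X hη A.smooth_ξ, map_sub, A.φ_φ]
  simp only [Pi.add_apply, Pi.smul_apply, Pi.smul_apply', dirDeriv_η hm X hY]
  module

theorem inner_derivφ_φ (hm : D.IsMetricCompatible) (X : VField n M) (hY : SmoothVField Y) (x : M)
    (v : TangentSpace (𝓡 n) x) :
    (inner ℝ (A.derivφ D X (A.φField Y) x) v : ℝ) = inner ℝ (A.derivφ D X Y x) (A.φ x v)
      + inner ℝ (nabla D X A.ξ x) (Y x) * A.η x v
      + A.η x (Y x) * inner ℝ (nabla D X A.ξ x) v := by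
  have h := congrArg (fun t ↦ (inner ℝ t v : ℝ)) (derivφ_φField (A := A) hm X hY x)
  simp only [inner_add_left, inner_φ_left, inner_smul_left, inner_ξ_left, RCLike.conj_to_real] at h
  rw [real_inner_comm (nabla D X A.ξ x) (Y x)] at h
  linarith

theorem inner_derivφ_ξ (hm : D.IsMetricCompatible) (X : VField n M) (hY : SmoothVField Y) (x : M) :
    (inner ℝ (A.derivφ D X Y x) (A.ξ x) : ℝ) = -inner ℝ (nabla D X A.ξ x) (A.φ x (Y x)) := by
  have h := dirDeriv_η (A := A) hm X (A.smooth_φField hY) x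
  simp only [φField_apply, A.η_φ, dirDeriv_const] at h
  rw [derivφ_apply, inner_sub_left, A.inner_ξ, A.inner_ξ, A.η_φ,
    real_inner_comm (A.φ x (Y x))]
  linarith

theorem IsCosymplectic.cyclic_derivφ (hA : A.IsCosymplectic α) (hD : IsLeviCivita D)
    (hX : SmoothVField X) (hY : SmoothVField Y) (hZ : SmoothVField Z) (x : M) :
    (inner ℝ (A.derivφ D X Y x) (Z x) : ℝ) + inner ℝ (A.derivφ D Y Z x) (X x)
      + inner ℝ (A.derivφ D Z X x) (Y x) =
      2 * α * wedgeOneTwo A.η A.fundForm x (X x) (Y x) (Z x) := by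
  rw [← hA.dΦ X Y Z hX hY hZ x]
  have key {X Y Z : VField n M} (hY : SmoothVField Y) (hZ : SmoothVField Z) :
      dirDeriv X (fun y ↦ A.fundForm y (Y y) (Z y)) x =
        inner ℝ (nabla D X (A.φField Y) x) (Z x) + inner ℝ (A.φ x (Y x)) (nabla D X Z x) :=
    dirDeriv_inner hD.metric X (A.smooth_φField hY) hZ x
  rw [extDerivTwo, key hY hZ, key hZ hX, key hX hY, ← hD.nabla_sub_nabla hX hY,
    ← hD.nabla_sub_nabla hY hZ, ← hD.nabla_sub_nabla hZ hX]
  have e (u v : TangentSpace (𝓡 n) x) :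
      (inner ℝ (A.φ x u) v : ℝ) = -inner ℝ (A.φ x v) u := by
    rw [inner_φ_left, real_inner_comm]
  simp only [derivφ_apply, fundForm, inner_sub_left, Pi.sub_apply, map_sub]
  linarith [e (X x) (nabla D Z Y x), e (Y x) (nabla D X Z x), e (Z x) (nabla D Y X x)]

theorem IsCosymplectic.normal_derivφ (hA : A.IsCosymplectic α) (hD : IsLeviCivita D)
    (hX : SmoothVField X) (hY : SmoothVField Y) (x : M) :
    A.derivφ D (A.φField X) Y x - A.derivφ D (A.φField Y) X x + A.φ x (A.derivφ D Y X x)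
      - A.φ x (A.derivφ D X Y x) = 0 := by
  have h := hA.normal X Y hX hY x
  rw [nijenhuis, hA.closed X Y hX hY x, zero_smul, add_zero,
    ← hD.nabla_sub_nabla (A.smooth_φField hX) (A.smooth_φField hY),
    ← hD.nabla_sub_nabla (A.smooth_φField hX) hY, ← hD.nabla_sub_nabla hX (A.smooth_φField hY),
    ← hD.nabla_sub_nabla hX hY] at h
  rw [← h]
  simp only [derivφ_apply, Pi.sub_apply, map_sub]
  module

/-- On an `α`-cosymplectic manifold `(∇_X φ)Y = α (g(φX, Y) ξ - η(Y) φX)`. The cyclic sum of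
`g((∇φ)·, ·)` is `dΦ`; comparing it at `(X, Y, Z)` and at `(X, φY, φZ)` and removing the remaining
terms with the normality condition isolates `2 g((∇_X φ)Y, Z)`. -/
theorem IsCosymplectic.derivφ_eq [T2Space M] (hA : A.IsCosymplectic α) (hD : IsLeviCivita D)
    (hX : SmoothVField X) (hY : SmoothVField Y) : A.derivφ D X Y = A.modelDerivφ α X Y := by
  ext1 x
  refine ext_inner_right ℝ fun v ↦ ?_
  obtain ⟨Z, hZ, rfl⟩ := exists_smoothVField_apply_eq x v
  have hm := hD.metric
  have hφY := A.smooth_φField hY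
  have hφZ := A.smooth_φField hZ
  have c1 := hA.cyclic_derivφ hD hX hY hZ x
  have c2 := hA.cyclic_derivφ hD hX hφY hφZ x
  have N := congrArg (fun t ↦ (inner ℝ t (A.φ x (X x)) : ℝ)) (hA.normal_derivφ hD hY hZ x)
  simp only [inner_add_left, inner_sub_left, inner_φ_left, A.φ_φ, inner_add_right, inner_neg_right,
    inner_smul_right, inner_zero_left, inner_derivφ_ξ hm _ hZ, inner_derivφ_ξ hm _ hY] at N
  -- `g((∇_X φ)φY, φZ)`
  have d1 := inner_derivφ_φ (A := A) hm X hY x (A.φField Z x)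
  simp only [φField_apply, A.φ_φ, A.η_φ, inner_add_right, inner_neg_right, inner_smul_right,
    inner_derivφ_ξ hm _ hY] at d1
  -- `g((∇_{φY} φ)φZ, X)`
  have d2 := inner_derivφ_φ (A := A) hm (A.φField Y) hZ x (X x)
  -- `g((∇_{φZ} φ)X, φY)`
  have d3 := inner_derivφ_skew (A := A) hm (A.φField Z) hX hφY x
  have d4 := inner_derivφ_φ (A := A) hm (A.φField Z) hY x (X x)
  have s1 := inner_derivφ_skew (A := A) hm Z hX hY x
  -- symmetry of `∇ξ`
  have b1 := hA.inner_nabla_ξ_comm hD hZ hφY x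
  have b2 := hA.inner_nabla_ξ_comm hD hY hφZ x
  have b3 := hA.inner_nabla_ξ_comm hD hX hφY x
  have b4 := hA.inner_nabla_ξ_comm hD hX hφZ x
  have p1 : (inner ℝ (A.φ x (Z x)) (X x) : ℝ) = -inner ℝ (A.φ x (X x)) (Z x) := by
    rw [inner_φ_left, real_inner_comm]
  have p2 : (inner ℝ (Y x) (A.φ x (Z x)) : ℝ) = -inner ℝ (A.φ x (Y x)) (Z x) := by
    rw [inner_φ_left, neg_neg]
  have p3 : (inner ℝ (A.ξ x) (A.φ x (Z x)) : ℝ) = 0 := by rw [inner_ξ_left, A.η_φ]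
  simp only [wedgeOneTwo, fundForm, φField_apply, A.η_φ, A.φ_φ, inner_add_left, inner_neg_left,
    inner_smul_left, RCLike.conj_to_real, p1, p2, p3] at *
  simp only [modelDerivφ, inner_sub_left, inner_smul_left, RCLike.conj_to_real, inner_ξ_left]
  rw [d1, d2, d3, d4] at c2
  linear_combination (1 / 2) * c1 - (1 / 2) * c2 + (1 / 2) * N - (1 / 2) * s1
    + (1 / 2) * A.η x (X x) * (b2 - b1) - (1 / 2) * A.η x (Z x) * b3
    + (1 / 2) * A.η x (Y x) * b4

/-- On an `α`-cosymplectic manifold `∇_X ξ = α (X - η(X) ξ)`. -/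
theorem IsCosymplectic.nabla_ξ [T2Space M] (hA : A.IsCosymplectic α) (hD : IsLeviCivita D)
    (hX : SmoothVField X) (x : M) :
    nabla D X A.ξ x = α • (X x - A.η x (X x) • A.ξ x) := by
  have h := congrFun (hA.derivφ_eq hD hX A.smooth_ξ) x
  have h0 : A.φField A.ξ = (0 : ℝ) • A.ξ := by
    ext1 y
    simp [φField_apply, A.φ_ξ]
  rw [derivφ_apply, h0, nabla_const_smul D X 0 A.smooth_ξ, modelDerivφ, A.inner_ξ, A.η_φ, A.η_ξ]
    at h
  have h' := congrArg (A.φ x) h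
  simp only [zero_smul, Pi.zero_apply, zero_sub, map_neg, map_smul, A.φ_φ, one_smul,
    η_nabla_ξ hD.metric] at h'
  rw [add_zero, neg_neg] at h'
  rw [h']
  module

end AlmostContactMetric

end Cosymplectic

/-! ### The Riemann tensor of an `α`-cosymplectic manifold -/

section CurvatureTensor

variable {n : ℕ} {M : Type*} [TopologicalSpace M] [T2Space M]
  [ChartedSpace (EuclideanSpace ℝ (Fin n)) M]
  [RiemannianBundle (fun x : M ↦ TangentSpace (𝓡 n) x)] [IsManifold (𝓡 n) ∞ M]
  [IsContMDiffRiemannianBundle (𝓡 n) ∞ (EuclideanSpace ℝ (Fin n))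
    (fun x : M ↦ TangentSpace (𝓡 n) x)]
  {D : Connection n M}

namespace IsLeviCivita

/-- The Riemann tensor at a point may be computed from any smooth fields with the given values. -/
theorem curvature_apply (h : IsLeviCivita D) {X Y Z : VField n M} (hX : SmoothVField X)
    (hY : SmoothVField Y) (hZ : SmoothVField Z) (x : M) :
    curvature D x (X x) (Y x) (Z x) = curvatureField D X Y Z x := by
  obtain ⟨X', hX', eX⟩ := exists_smoothVField_eventuallyEq_extend x (X x)
  obtain ⟨Y', hY', eY⟩ := exists_smoothVField_eventuallyEq_extend x (Y x)
  obtain ⟨Z', hZ', eZ⟩ := exists_smoothVField_eventuallyEq_extend x (Z x)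
  rw [curvature_eq_curvatureField_of_eventuallyEq h.smooth hX' hY' hZ' eX eY eZ]
  have eX' : X' x = X x := eX.eq_of_nhds.trans (extField_apply_self _)
  have eY' : Y' x = Y x := eY.eq_of_nhds.trans (extField_apply_self _)
  have eZ' : Z' x = Z x := eZ.eq_of_nhds.trans (extField_apply_self _)
  rw [curvatureField_congr_right h.smooth h.metric hX' hY' hZ' hZ eZ']
  -- By pair symmetry, tensoriality in the last argument yields tensoriality in the others.
  refine ext_inner_right ℝ fun v ↦ ?_
  obtain ⟨V, hV, rfl⟩ := exists_smoothVField_apply_eq x v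
  rw [h.inner_curvatureField_pair hX' hY' hZ hV, h.inner_curvatureField_pair hX hY hZ hV,
    curvatureField_congr_right h.smooth h.metric hZ hV hX' hX eX', eY']

variable {x : M} (u v w z : TangentSpace (𝓡 n) x)

theorem curvature_swap (h : IsLeviCivita D) : curvature D x u v w = -curvature D x v u w := by
  obtain ⟨U, hU, rfl⟩ := exists_smoothVField_apply_eq x u
  obtain ⟨V, hV, rfl⟩ := exists_smoothVField_apply_eq x v
  obtain ⟨W, hW, rfl⟩ := exists_smoothVField_apply_eq x w
  rw [h.curvature_apply hU hV hW, h.curvature_apply hV hU hW, curvatureField_swap]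

theorem inner_curvature_skew (h : IsLeviCivita D) :
    (inner ℝ (curvature D x u v w) z : ℝ) = -inner ℝ (curvature D x u v z) w := by
  obtain ⟨U, hU, rfl⟩ := exists_smoothVField_apply_eq x u
  obtain ⟨V, hV, rfl⟩ := exists_smoothVField_apply_eq x v
  obtain ⟨W, hW, rfl⟩ := exists_smoothVField_apply_eq x w
  obtain ⟨Z, hZ, rfl⟩ := exists_smoothVField_apply_eq x z
  rw [h.curvature_apply hU hV hW, h.curvature_apply hU hV hZ,
    inner_curvatureField_skew h.smooth h.metric hU hV hW hZ, real_inner_comm]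

theorem curvature_bianchi (h : IsLeviCivita D) :
    curvature D x u v w + curvature D x v w u + curvature D x w u v = 0 := by
  obtain ⟨U, hU, rfl⟩ := exists_smoothVField_apply_eq x u
  obtain ⟨V, hV, rfl⟩ := exists_smoothVField_apply_eq x v
  obtain ⟨W, hW, rfl⟩ := exists_smoothVField_apply_eq x w
  rw [h.curvature_apply hU hV hW, h.curvature_apply hV hW hU, h.curvature_apply hW hU hV,
    h.bianchi hU hV hW]

theorem inner_curvature_pair (h : IsLeviCivita D) :
    (inner ℝ (curvature D x u v w) z : ℝ) = inner ℝ (curvature D x w z u) v := by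
  obtain ⟨U, hU, rfl⟩ := exists_smoothVField_apply_eq x u
  obtain ⟨V, hV, rfl⟩ := exists_smoothVField_apply_eq x v
  obtain ⟨W, hW, rfl⟩ := exists_smoothVField_apply_eq x w
  obtain ⟨Z, hZ, rfl⟩ := exists_smoothVField_apply_eq x z
  rw [h.curvature_apply hU hV hW, h.curvature_apply hW hZ hU,
    h.inner_curvatureField_pair hU hV hW hZ]

/-- The bilinear form `(a, b) ↦ g(R(a, u)w, b)`. -/
def curvatureForm (h : IsLeviCivita D) :
    TangentSpace (𝓡 n) x →ₗ[ℝ] TangentSpace (𝓡 n) x →ₗ[ℝ] ℝ :=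
  LinearMap.mk₂ ℝ (fun a b ↦ (inner ℝ (curvature D x a u w) b : ℝ))
    (fun a a' b ↦ by
      simp only [h.inner_curvature_pair _ u w b, h.inner_curvature_skew w b _ u, inner_add_right]
      ring)
    (fun c a b ↦ by
      simp only [h.inner_curvature_pair _ u w b, h.inner_curvature_skew w b _ u, inner_smul_right,
        smul_eq_mul]
      ring)
    (fun a b b' ↦ inner_add_right _ _ _)
    (fun c a b ↦ inner_smul_right _ _ _)

end IsLeviCivita

end CurvatureTensor

section CosymplecticCurvature

variable {n : ℕ} {M : Type*} [TopologicalSpace M] [T2Space M]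
  [ChartedSpace (EuclideanSpace ℝ (Fin n)) M]
  [RiemannianBundle (fun x : M ↦ TangentSpace (𝓡 n) x)] [IsManifold (𝓡 n) ∞ M]
  [IsContMDiffRiemannianBundle (𝓡 n) ∞ (EuclideanSpace ℝ (Fin n))
    (fun x : M ↦ TangentSpace (𝓡 n) x)]
  {D D' : Connection n M} {A : AlmostContactMetric n M} {α : ℝ} {X Y Z : VField n M}

namespace AlmostContactMetric

namespace IsCosymplectic

theorem nabla_ξ_eq (hA : A.IsCosymplectic α) (hD : IsLeviCivita D) (hX : SmoothVField X) :
    nabla D X A.ξ = α • X + (-α) • ((fun y ↦ A.η y (X y)) • A.ξ) := by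
  ext1 y
  rw [hA.nabla_ξ hD hX]
  simp only [Pi.add_apply, Pi.smul_apply, Pi.smul_apply']
  module

theorem curvatureField_ξ (hA : A.IsCosymplectic α) (hD : IsLeviCivita D) (hX : SmoothVField X)
    (hY : SmoothVField Y) (x : M) :
    curvatureField D X Y A.ξ x = α ^ 2 • (A.η x (X x) • Y x - A.η x (Y x) • X x) := by
  have key {X Y : VField n M} (hX : SmoothVField X) (hY : SmoothVField Y) :
      nabla D X (nabla D Y A.ξ) x = α • nabla D X Y x
        - α • (dirDeriv X (fun y ↦ A.η y (Y y)) x • A.ξ x)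
        - (α * A.η x (Y x)) • (α • (X x - A.η x (X x) • A.ξ x)) := by
    have hη := smooth_η_apply (A := A) hY
    have hs := A.smooth_ξ.smul hη
    rw [hA.nabla_ξ_eq hD hY, nabla_add D X (hY.const_smul _) (hs.const_smul _),
      nabla_const_smul D X _ hY, nabla_const_smul D X _ hs, nabla_smul D X hη A.smooth_ξ]
    simp only [Pi.add_apply, Pi.smul_apply, Pi.smul_apply', hA.nabla_ξ hD hX]
    module
  rw [curvatureField_eq, Pi.sub_apply, Pi.sub_apply, key hX hY, key hY hX,
    hA.nabla_ξ hD (hX.bracket hY), hA.η_bracket hX hY, ← hD.nabla_sub_nabla hX hY, Pi.sub_apply]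
  module

theorem nabla_φField (hA : A.IsCosymplectic α) (hD : IsLeviCivita D) (hX : SmoothVField X)
    (hY : SmoothVField Y) (x : M) :
    nabla D X (A.φField Y) x = A.φ x (nabla D X Y x) + A.modelDerivφ α X Y x := by
  rw [← hA.derivφ_eq hD hX hY, derivφ_apply]
  module

/-- The commutator of `R(X, Y)` with `φ`. -/
theorem curvatureField_φField (hA : A.IsCosymplectic α) (hD : IsLeviCivita D)
    (hX : SmoothVField X) (hY : SmoothVField Y) (hZ : SmoothVField Z) (x : M) :
    curvatureField D X Y (A.φField Z) x = A.φ x (curvatureField D X Y Z x)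
      + α ^ 2 • ((inner ℝ (A.φ x (Y x)) (Z x) : ℝ) • X x - (inner ℝ (A.φ x (X x)) (Z x) : ℝ) • Y x
        - (inner ℝ (X x) (Z x) : ℝ) • A.φ x (Y x) + (inner ℝ (Y x) (Z x) : ℝ) • A.φ x (X x)) := by
  have hm := hD.metric
  -- the Leibniz rule for `∇_X` applied to `∇_Y(φZ) = φ(∇_Y Z) + α (g(φY, Z) ξ - η(Z) φY)`
  have key {X Y : VField n M} (hX : SmoothVField X) (hY : SmoothVField Y) :
      nabla D X (nabla D Y (A.φField Z)) x = A.φ x (nabla D X (nabla D Y Z) x)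
        + A.modelDerivφ α X (nabla D Y Z) x
        + α • (((inner ℝ (nabla D X (A.φField Y) x) (Z x) : ℝ)
            + inner ℝ (A.φ x (Y x)) (nabla D X Z x)) • A.ξ x
          + (inner ℝ (A.φ x (Y x)) (Z x) : ℝ) • nabla D X A.ξ x
          - (A.η x (nabla D X Z x) + inner ℝ (Z x) (nabla D X A.ξ x)) • A.φ x (Y x)
          - A.η x (Z x) • nabla D X (A.φField Y) x) := by
    have hφY := A.smooth_φField hY
    have hη := smooth_η_apply (A := A) hZ
    have e : nabla D Y (A.φField Z) = A.φField (nabla D Y Z)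
        + α • ((fun y ↦ (inner ℝ (A.φField Y y) (Z y) : ℝ)) • A.ξ
          - (fun y ↦ A.η y (Z y)) • A.φField Y) := by
      ext1 y
      exact hA.nabla_φField hD hY hZ y
    have hd := dirDeriv_inner hm X hφY hZ x
    simp only [φField_apply] at hd
    have s1 := A.smooth_ξ.smul (hφY.inner hZ)
    have s2 := hφY.smul hη
    rw [e, nabla_add D X (A.smooth_φField (hY.nabla hD.smooth hZ)) ((s1.sub s2).const_smul _),
      nabla_const_smul D X _ (s1.sub s2), nabla_sub D X s1 s2,
      nabla_smul D X (hφY.inner hZ) A.smooth_ξ, nabla_smul D X hη hφY]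
    simp only [Pi.add_apply, Pi.sub_apply, Pi.smul_apply, Pi.smul_apply', dirDeriv_η hm X hZ,
      hd, hA.nabla_φField hD hX (hY.nabla hD.smooth hZ), φField_apply]
    module
  rw [curvatureField_eq, curvatureField_eq, Pi.sub_apply, Pi.sub_apply, key hX hY, key hY hX,
    hA.nabla_φField hD (hX.bracket hY) hZ, hA.nabla_φField hD hX hY, hA.nabla_φField hD hY hX,
    hA.nabla_ξ hD hX, hA.nabla_ξ hD hY, Pi.sub_apply, Pi.sub_apply, map_sub, map_sub]
  simp only [modelDerivφ, ← hD.nabla_sub_nabla hX hY, Pi.sub_apply, map_sub, inner_add_left,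
    inner_sub_left, inner_sub_right, inner_smul_left, inner_smul_right, RCLike.conj_to_real,
    inner_ξ_left, A.inner_ξ, inner_φ_left]
  rw [real_inner_comm (X x) (Z x), real_inner_comm (Y x) (Z x),
    real_inner_comm (A.φ x (X x)) (Y x), inner_φ_left A x (X x) (Y x)]
  module

variable {x : M} (u v w : TangentSpace (𝓡 n) x)

theorem curvature_ξ (hA : A.IsCosymplectic α) (hD : IsLeviCivita D) :
    curvature D x u v (A.ξ x) = α ^ 2 • (A.η x u • v - A.η x v • u) := by
  obtain ⟨U, hU, rfl⟩ := exists_smoothVField_apply_eq x u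
  obtain ⟨V, hV, rfl⟩ := exists_smoothVField_apply_eq x v
  rw [hD.curvature_apply hU hV A.smooth_ξ, hA.curvatureField_ξ hD hU hV]

theorem curvature_φ (hA : A.IsCosymplectic α) (hD : IsLeviCivita D) :
    curvature D x u v (A.φ x w) = A.φ x (curvature D x u v w)
      + α ^ 2 • ((inner ℝ (A.φ x v) w : ℝ) • u - (inner ℝ (A.φ x u) w : ℝ) • v
        - (inner ℝ u w : ℝ) • A.φ x v + (inner ℝ v w : ℝ) • A.φ x u) := by
  obtain ⟨U, hU, rfl⟩ := exists_smoothVField_apply_eq x u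
  obtain ⟨V, hV, rfl⟩ := exists_smoothVField_apply_eq x v
  obtain ⟨W, hW, rfl⟩ := exists_smoothVField_apply_eq x w
  rw [← φField_apply, hD.curvature_apply hU hV (A.smooth_φField hW),
    hA.curvatureField_φField hD hU hV hW, hD.curvature_apply hU hV hW]

end IsCosymplectic

end AlmostContactMetric

end CosymplecticCurvature

/-! ### Traces and the `*`-Ricci tensor -/

section Trace

/-- A bilinear form contracted against a skew endomorphism. -/
theorem sum_apply_skew {V ι : Type*} [NormedAddCommGroup V] [InnerProductSpace ℝ V] [Fintype ι]
    (b : OrthonormalBasis ι ℝ V) (B : V →ₗ[ℝ] V →ₗ[ℝ] ℝ) (T : V → V)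
    (hT : ∀ u v, (inner ℝ (T u) v : ℝ) = -inner ℝ u (T v)) :
    ∑ i, B (T (b i)) (b i) = -∑ i, B (b i) (T (b i)) := by
  have h1 : ∀ i, B (T (b i)) (b i) = ∑ j, (inner ℝ (b j) (T (b i)) : ℝ) * B (b j) (b i) := by
    intro i
    conv_lhs => rw [← b.sum_repr' (T (b i))]
    simp
  have h2 : ∀ i, B (b i) (T (b i)) = ∑ j, (inner ℝ (b j) (T (b i)) : ℝ) * B (b i) (b j) := by
    intro i
    conv_lhs => rw [← b.sum_repr' (T (b i))]
    simp
  simp only [h1, h2]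
  rw [Finset.sum_comm, ← Finset.sum_neg_distrib]
  refine Finset.sum_congr rfl fun i _ ↦ ?_
  rw [← Finset.sum_neg_distrib]
  refine Finset.sum_congr rfl fun j _ ↦ ?_
  rw [real_inner_comm, hT]
  ring

variable {n : ℕ} {M : Type*} [TopologicalSpace M] [ChartedSpace (EuclideanSpace ℝ (Fin n)) M]
  [RiemannianBundle (fun x : M ↦ TangentSpace (𝓡 n) x)] {x : M}

theorem metricTrace_add (B B' : TangentSpace (𝓡 n) x → TangentSpace (𝓡 n) x → ℝ) :
    metricTrace x (fun u v ↦ B u v + B' u v) = metricTrace x B + metricTrace x B' :=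
  Finset.sum_add_distrib

theorem metricTrace_mul (c : ℝ) (B : TangentSpace (𝓡 n) x → TangentSpace (𝓡 n) x → ℝ) :
    metricTrace x (fun u v ↦ c * B u v) = c * metricTrace x B :=
  (Finset.mul_sum _ _ _).symm

theorem metricTrace_inner_mul_inner (a b : TangentSpace (𝓡 n) x) :
    metricTrace x (fun u v ↦ (inner ℝ a u : ℝ) * inner ℝ v b) = inner ℝ a b :=
  (stdOrthonormalBasis ℝ (TangentSpace (𝓡 n) x)).sum_inner_mul_inner a b

theorem metricTrace_inner :
    metricTrace x (fun u v : TangentSpace (𝓡 n) x ↦ (inner ℝ u v : ℝ)) = n := by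
  have : Module.finrank ℝ (TangentSpace (𝓡 n) x) = n := finrank_euclideanSpace_fin
  simp [metricTrace, this]

variable [IsManifold (𝓡 n) ∞ M]

theorem divergence_eq_metricTrace (D : Connection n M) (X : VField n M) (x : M) :
    divergence D X x = metricTrace x (fun u v ↦ (inner ℝ (D X x u) v : ℝ)) := by
  rw [divergence, LinearMap.trace_eq_sum_inner _ (stdOrthonormalBasis ℝ (TangentSpace (𝓡 n) x))]
  exact Finset.sum_congr rfl fun i _ ↦ real_inner_comm _ _

theorem metricTrace_lieMetric (D : Connection n M) (X : VField n M) (x : M) :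
    metricTrace x (lieMetric D X x) = 2 * divergence D X x := by
  rw [divergence_eq_metricTrace, ← metricTrace_mul]
  refine Finset.sum_congr rfl fun i _ ↦ ?_
  rw [lieMetric, real_inner_comm (D X x _)]
  ring

theorem AlmostContactMetric.metricTrace_η_mul_η (A : AlmostContactMetric n M) (x : M) :
    metricTrace x (fun u v ↦ A.η x u * A.η x v) = 1 := by
  rw [← A.η_ξ x, ← A.inner_ξ, ← metricTrace_inner_mul_inner]
  simp only [A.inner_ξ, A.inner_ξ_left]

end Trace

section StarRicci

variable {n : ℕ} {M : Type*} [TopologicalSpace M] [T2Space M]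
  [ChartedSpace (EuclideanSpace ℝ (Fin n)) M]
  [RiemannianBundle (fun x : M ↦ TangentSpace (𝓡 n) x)] [IsManifold (𝓡 n) ∞ M]
  [IsContMDiffRiemannianBundle (𝓡 n) ∞ (EuclideanSpace ℝ (Fin n))
    (fun x : M ↦ TangentSpace (𝓡 n) x)]
  {D D' : Connection n M} {A : AlmostContactMetric n M} {α : ℝ}

namespace AlmostContactMetric

/-- By the first Bianchi identity and pair symmetry, the contraction defining the `*`-Ricci tensor
of the Levi-Civita connection is `S*(u, v) = ∑ g(R(eᵢ, u)φv, φeᵢ)`. -/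
theorem starRicci_eq_metricTrace (hD : IsLeviCivita D) (x : M) (u v : TangentSpace (𝓡 n) x) :
    A.starRicci D x u v =
      metricTrace x (fun e e' ↦ (inner ℝ (curvature D x e u (A.φ x v)) (A.φ x e') : ℝ)) := by
  have h := sum_apply_skew (stdOrthonormalBasis ℝ (TangentSpace (𝓡 n) x))
    (hD.curvatureForm u (A.φ x v)) (A.φ x) (A.inner_φ_left x)
  change ∑ i, (inner ℝ (curvature D x (A.φ x (stdOrthonormalBasis ℝ (TangentSpace (𝓡 n) x) i)) u
      (A.φ x v)) (stdOrthonormalBasis ℝ (TangentSpace (𝓡 n) x) i) : ℝ) =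
    -metricTrace x (fun e e' ↦ (inner ℝ (curvature D x e u (A.φ x v)) (A.φ x e') : ℝ)) at h
  have key (e : TangentSpace (𝓡 n) x) :
      (inner ℝ (curvature D x u (A.φ x v) (A.φ x e)) e : ℝ) =
        inner ℝ (curvature D x e u (A.φ x v)) (A.φ x e)
          - inner ℝ (curvature D x (A.φ x e) u (A.φ x v)) e := by
    have b := congrArg (fun t ↦ (inner ℝ t e : ℝ))
      (hD.curvature_bianchi u (A.φ x v) (A.φ x e))
    simp only [inner_add_left, inner_zero_left] at b
    have p := hD.inner_curvature_pair (A.φ x v) (A.φ x e) u e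
    have s := congrArg (fun t ↦ (inner ℝ t (A.φ x e) : ℝ)) (hD.curvature_swap u e (A.φ x v))
    simp only [inner_neg_left] at s
    linarith
  rw [starRicci, metricTrace, Finset.sum_congr rfl fun i _ ↦ key _, Finset.sum_sub_distrib, h]
  simp only [metricTrace]
  ring

/-- On an `α`-cosymplectic manifold `S* = S + α² (n - 2) g + α² η ⊗ η`. -/
theorem IsCosymplectic.starRicci_eq (hA : A.IsCosymplectic α) (hD : IsLeviCivita D) (x : M)
    (u v : TangentSpace (𝓡 n) x) :
    A.starRicci D x u v = ricci D x u v + α ^ 2 * ((n : ℝ) - 2) * inner ℝ u v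
      + α ^ 2 * (A.η x u * A.η x v) := by
  have key (e : TangentSpace (𝓡 n) x) :
      (inner ℝ (curvature D x e u (A.φ x v)) (A.φ x e) : ℝ) =
        inner ℝ (curvature D x e u v) e
        + (α ^ 2 * inner ℝ u v * inner ℝ e e
          + (-α ^ 2 * (inner ℝ v e * inner ℝ e u)
            + -α ^ 2 * (inner ℝ (A.φ x v) e * inner ℝ e (A.φ x u)))) := by
    have s := hD.inner_curvature_skew e u v (A.ξ x)
    rw [hA.curvature_ξ e u hD] at s
    rw [hA.curvature_φ e u v hD]
    simp only [inner_add_left, inner_sub_left, inner_smul_left, RCLike.conj_to_real, A.inner_φ_φ,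
      A.inner_ξ] at s ⊢
    rw [s, real_inner_comm (A.φ x e) e, A.inner_φ_self, A.inner_φ x u e,
      real_inner_comm e (A.φ x u), A.inner_φ_left x e v,
      real_inner_comm (A.φ x v) e, real_inner_comm v e, real_inner_comm e u]
    ring
  rw [starRicci_eq_metricTrace hD, metricTrace, Finset.sum_congr rfl fun i _ ↦ key _]
  change metricTrace x (fun e e' ↦ (inner ℝ (curvature D x e u v) e' : ℝ)
        + (α ^ 2 * inner ℝ u v * inner ℝ e e'
          + (-α ^ 2 * (inner ℝ v e * inner ℝ e' u)
            + -α ^ 2 * (inner ℝ (A.φ x v) e * inner ℝ e' (A.φ x u))))) = _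
  simp only [metricTrace_add, metricTrace_mul, metricTrace_inner, metricTrace_inner_mul_inner,
    A.inner_φ_φ]
  rw [ricci, real_inner_comm]
  ring

/-- On an `α`-cosymplectic manifold `r* = r + α² (n - 1)²`. -/
theorem IsCosymplectic.starScalar_eq (hA : A.IsCosymplectic α) (hD : IsLeviCivita D) (x : M) :
    A.starScalar D x = scalarCurvature D x + α ^ 2 * ((n : ℝ) - 1) ^ 2 := by
  have : A.starRicci D x = fun u v ↦ ricci D x u v + α ^ 2 * ((n : ℝ) - 2) * inner ℝ u v
      + α ^ 2 * (A.η x u * A.η x v) := funext₂ (hA.starRicci_eq hD x)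
  rw [starScalar, this, metricTrace_add, metricTrace_add, metricTrace_mul, metricTrace_mul,
    metricTrace_inner, A.metricTrace_η_mul_η, scalarCurvature]
  ring

end AlmostContactMetric

end StarRicci

/-! ### The quarter-symmetric metric connection -/

section QuarterSymmetric

variable {n : ℕ} {M : Type*} [TopologicalSpace M] [T2Space M]
  [ChartedSpace (EuclideanSpace ℝ (Fin n)) M]
  [RiemannianBundle (fun x : M ↦ TangentSpace (𝓡 n) x)] [IsManifold (𝓡 n) ∞ M]
  [IsContMDiffRiemannianBundle (𝓡 n) ∞ (EuclideanSpace ℝ (Fin n))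
    (fun x : M ↦ TangentSpace (𝓡 n) x)]
  {D D' : Connection n M} {A : AlmostContactMetric n M} {α : ℝ} {X Y Z : VField n M}

namespace IsQuarterSymmetricMetric

/-- The quarter-symmetric metric connection is `∇̃_X Y = ∇_X Y - η(X) φY`: two metric connections
are determined by the difference of their torsions, as in the Koszul formula. -/
theorem nabla_eq (hD' : IsQuarterSymmetricMetric A D') (hD : IsLeviCivita D)
    (hX : SmoothVField X) (hY : SmoothVField Y) (x : M) :
    nabla D' X Y x = nabla D X Y x - A.η x (X x) • A.φ x (Y x) := by
  refine ext_inner_right ℝ fun v ↦ ?_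
  obtain ⟨Z, hZ, rfl⟩ := exists_smoothVField_apply_eq x v
  have T {X Y : VField n M} (hX : SmoothVField X) (hY : SmoothVField Y) (Z : VField n M) :
      (inner ℝ (nabla D' X Y x) (Z x) - inner ℝ (nabla D' Y X x) (Z x) : ℝ) =
        inner ℝ (nabla D X Y x) (Z x) - inner ℝ (nabla D Y X x) (Z x)
          + (A.η x (Y x) * inner ℝ (A.φ x (X x)) (Z x)
            - A.η x (X x) * inner ℝ (A.φ x (Y x)) (Z x)) := by
    have h1 := D'.torsion_apply (hX.mdifferentiableAt x) (hY.mdifferentiableAt x)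
    rw [hD'.torsion_eq] at h1
    have h2 := congrFun (hD.nabla_sub_nabla hX hY) x
    have h3 : nabla D' X Y x - nabla D' Y X x = nabla D X Y x - nabla D Y X x
        + (A.η x (Y x) • A.φ x (X x) - A.η x (X x) • A.φ x (Y x)) := by
      rw [h1]
      simp only [Pi.sub_apply] at h2
      rw [h2]
      change nabla D' X Y x - nabla D' Y X x = bracket X Y x
        + (nabla D' X Y x - nabla D' Y X x - bracket X Y x)
      module
    have h4 := congrArg (fun t ↦ (inner ℝ t (Z x) : ℝ)) h3
    simpa only [inner_add_left, inner_sub_left, inner_smul_left, RCLike.conj_to_real] using h4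
  have S (X : VField n M) {Y Z : VField n M} (hY : SmoothVField Y) (hZ : SmoothVField Z) :
      (inner ℝ (nabla D' X Y x) (Z x) + inner ℝ (nabla D' X Z x) (Y x) : ℝ) =
        inner ℝ (nabla D X Y x) (Z x) + inner ℝ (nabla D X Z x) (Y x) := by
    have h1 := dirDeriv_inner hD.metric X hY hZ x
    rw [dirDeriv_inner hD'.metric X hY hZ x, real_inner_comm (nabla D' X Z x),
      real_inner_comm (nabla D X Z x)] at h1
    exact h1
  have e (u v : TangentSpace (𝓡 n) x) :
      (inner ℝ (A.φ x u) v : ℝ) = -inner ℝ (A.φ x v) u := by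
    rw [A.inner_φ_left, real_inner_comm]
  rw [inner_sub_left, inner_smul_left, RCLike.conj_to_real]
  linear_combination (1 / 2) * (T hX hY Z - T hY hZ X - T hX hZ Y + S X hY hZ + S Y hX hZ
    - S Z hX hY) + (1 / 2) * (A.η x (Y x) * e (Z x) (X x) - A.η x (Z x) * e (Y x) (X x)
    + A.η x (X x) * e (Z x) (Y x))

theorem nabla_eq_sub_smul (hD' : IsQuarterSymmetricMetric A D') (hD : IsLeviCivita D)
    (hX : SmoothVField X) (hY : SmoothVField Y) :
    nabla D' X Y = nabla D X Y - (fun y ↦ A.η y (X y)) • A.φField Y :=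
  funext (hD'.nabla_eq hD hX hY)

theorem curvatureField_eq (hA : A.IsCosymplectic α) (hD' : IsQuarterSymmetricMetric A D')
    (hD : IsLeviCivita D) (hX : SmoothVField X) (hY : SmoothVField Y) (hZ : SmoothVField Z)
    (x : M) :
    curvatureField D' X Y Z x = curvatureField D X Y Z x
      + A.η x (X x) • A.modelDerivφ α Y Z x - A.η x (Y x) • A.modelDerivφ α X Z x := by
  have hφZ := A.smooth_φField hZ
  have key {X Y : VField n M} (hX : SmoothVField X) (hY : SmoothVField Y) :
      nabla D' X (nabla D' Y Z) x = nabla D X (nabla D Y Z) x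
        - (dirDeriv X (fun y ↦ A.η y (Y y)) x • A.φ x (Z x)
          + A.η x (Y x) • (A.φ x (nabla D X Z x) + A.modelDerivφ α X Z x))
        - A.η x (X x) • (A.φ x (nabla D Y Z x) - A.η x (Y x) • A.φ x (A.φ x (Z x))) := by
    have hη := AlmostContactMetric.smooth_η_apply (A := A) hY
    rw [hD'.nabla_eq hD hX (hY.nabla hD'.smooth hZ), hD'.nabla_eq_sub_smul hD hY hZ,
      nabla_sub D X (hY.nabla hD.smooth hZ) (hφZ.smul hη), nabla_smul D X hη hφZ]
    simp only [Pi.add_apply, Pi.sub_apply, Pi.smul_apply', hA.nabla_φField hD hX hZ,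
      AlmostContactMetric.φField_apply, map_sub, map_smul]
  rw [CosymplecticSoliton.curvatureField_eq, CosymplecticSoliton.curvatureField_eq, Pi.sub_apply,
    Pi.sub_apply, Pi.sub_apply, Pi.sub_apply, key hX hY, key hY hX,
    hD'.nabla_eq hD (hX.bracket hY) hZ, hA.η_bracket hX hY]
  module

variable {x : M} (u v w : TangentSpace (𝓡 n) x)

theorem curvature_eq (hA : A.IsCosymplectic α) (hD' : IsQuarterSymmetricMetric A D')
    (hD : IsLeviCivita D) :
    curvature D' x u v w = curvature D x u v w
      + A.η x u • α • ((inner ℝ (A.φ x v) w : ℝ) • A.ξ x - A.η x w • A.φ x v)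
      - A.η x v • α • ((inner ℝ (A.φ x u) w : ℝ) • A.ξ x - A.η x w • A.φ x u) := by
  obtain ⟨U, hU, eU⟩ := exists_smoothVField_eventuallyEq_extend x u
  obtain ⟨V, hV, eV⟩ := exists_smoothVField_eventuallyEq_extend x v
  obtain ⟨W, hW, eW⟩ := exists_smoothVField_eventuallyEq_extend x w
  rw [curvature_eq_curvatureField_of_eventuallyEq hD'.smooth hU hV hW eU eV eW,
    curvature_eq_curvatureField_of_eventuallyEq hD.smooth hU hV hW eU eV eW,
    hD'.curvatureField_eq hA hD hU hV hW, AlmostContactMetric.modelDerivφ,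
    AlmostContactMetric.modelDerivφ, eU.eq_of_nhds.trans (extField_apply_self u),
    eV.eq_of_nhds.trans (extField_apply_self v), eW.eq_of_nhds.trans (extField_apply_self w)]

/-- The `*`-Ricci tensors of the two connections agree. -/
theorem starRicci_eq (hA : A.IsCosymplectic α) (hD' : IsQuarterSymmetricMetric A D')
    (hD : IsLeviCivita D) : A.starRicci D' x u v = A.starRicci D x u v := by
  have key (e : TangentSpace (𝓡 n) x) :
      (inner ℝ (curvature D' x u (A.φ x v) (A.φ x e)) e : ℝ) =
        inner ℝ (curvature D x u (A.φ x v) (A.φ x e)) e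
          + -(α * A.η x u) * (inner ℝ (A.φ x (A.φ x (A.φ x v))) e * inner ℝ e (A.ξ x)) := by
    rw [hD'.curvature_eq _ _ _ hA hD, A.η_φ, A.η_φ, A.inner_φ_left x (A.φ x (A.φ x v)) e]
    simp only [zero_smul, sub_zero, inner_add_left, inner_smul_left, RCLike.conj_to_real,
      A.inner_ξ_left, A.inner_ξ]
    ring
  rw [AlmostContactMetric.starRicci, metricTrace, Finset.sum_congr rfl fun i _ ↦ key _]
  change 1 / 2 * metricTrace x (fun e e' ↦
    (inner ℝ (curvature D x u (A.φ x v) (A.φ x e)) e' : ℝ)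
      + -(α * A.η x u) * (inner ℝ (A.φ x (A.φ x (A.φ x v))) e * inner ℝ e' (A.ξ x))) = _
  rw [metricTrace_add, metricTrace_mul, metricTrace_inner_mul_inner, A.inner_ξ, A.η_φ, mul_zero,
    add_zero]
  rfl

/-- The two Ricci tensors differ by a skew form: `S̃(u, v) = S(u, v) + α g(φu, v)`. -/
theorem ricci_eq (hA : A.IsCosymplectic α) (hD' : IsQuarterSymmetricMetric A D')
    (hD : IsLeviCivita D) : ricci D' x u v = ricci D x u v + α * inner ℝ (A.φ x u) v := by
  have key (e : TangentSpace (𝓡 n) x) :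
      (inner ℝ (curvature D' x e u v) e : ℝ) = inner ℝ (curvature D x e u v) e
        + (α * inner ℝ (A.φ x u) v * (A.η x e * A.η x e)
          + (-(α * A.η x v) * (inner ℝ (A.φ x u) e * inner ℝ e (A.ξ x))
            + α * A.η x u * (inner ℝ (A.φ x v) e * inner ℝ e (A.ξ x)))) := by
    rw [hD'.curvature_eq _ _ _ hA hD]
    simp only [inner_add_left, inner_sub_left, inner_smul_left, RCLike.conj_to_real,
      A.inner_ξ_left, A.inner_ξ, A.inner_φ_self]
    rw [A.inner_φ_left x e v, real_inner_comm (A.φ x v) e]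
    ring
  rw [ricci, metricTrace, Finset.sum_congr rfl fun i _ ↦ key _]
  change metricTrace x (fun e e' ↦ (inner ℝ (curvature D x e u v) e' : ℝ)
        + (α * inner ℝ (A.φ x u) v * (A.η x e * A.η x e')
          + (-(α * A.η x v) * (inner ℝ (A.φ x u) e * inner ℝ e' (A.ξ x))
            + α * A.η x u * (inner ℝ (A.φ x v) e * inner ℝ e' (A.ξ x))))) = _
  simp only [metricTrace_add, metricTrace_mul, metricTrace_inner_mul_inner, A.metricTrace_η_mul_η]
  rw [A.inner_ξ, A.inner_ξ, A.η_φ, A.η_φ, ricci]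
  ring

theorem scalarCurvature_eq (hA : A.IsCosymplectic α) (hD' : IsQuarterSymmetricMetric A D')
    (hD : IsLeviCivita D) (x : M) : scalarCurvature D' x = scalarCurvature D x := by
  rw [scalarCurvature, scalarCurvature, metricTrace, metricTrace]
  refine Finset.sum_congr rfl fun i _ ↦ ?_
  rw [hD'.ricci_eq _ _ hA hD, A.inner_φ_self, mul_zero, add_zero]

/-- Both connections give `ξ` the same covariant derivative, because `φξ = 0`. -/
theorem divergence_ξ (hD' : IsQuarterSymmetricMetric A D') (hD : IsLeviCivita D) (x : M) :
    divergence D' A.ξ x = divergence D A.ξ x := by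
  have : D' A.ξ x = D A.ξ x := by
    ext1 u
    obtain ⟨U, hU, rfl⟩ := exists_smoothVField_apply_eq x u
    have := hD'.nabla_eq hD hU A.smooth_ξ x
    rwa [A.φ_ξ, smul_zero, sub_zero] at this
  rw [divergence, divergence, this]

end IsQuarterSymmetricMetric

end QuarterSymmetric

end

end CosymplecticSoliton

/-! ### The trace of the soliton equation -/

open CosymplecticSoliton in
theorem theorem4p4 {n : ℕ} {M : Type*} [TopologicalSpace M] [T2Space M]
    [ChartedSpace (EuclideanSpace ℝ (Fin n)) M] [IsManifold (𝓡 n) ∞ M]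
    [RiemannianBundle (fun x : M ↦ TangentSpace (𝓡 n) x)]
    [IsContMDiffRiemannianBundle (𝓡 n) ∞ (EuclideanSpace ℝ (Fin n))
      (fun x : M ↦ TangentSpace (𝓡 n) x)]
    (A : AlmostContactMetric n M) (α : ℝ) (hA : A.IsCosymplectic α)
    (D : Connection n M) (hD : IsLeviCivita D)
    (D' : Connection n M) (hD' : IsQuarterSymmetricMetric A D')
    (Λ μ ρ q : ℝ)
    (hsol : A.IsStarSoliton D' Λ μ ρ q ∨ A.IsRicciFormSoliton D' α Λ μ ρ q)
    (f : M → ℝ) (hf : ContMDiff (𝓡 n) 𝓘(ℝ, ℝ) ∞ f) (hξ : A.ξ = gradient f) (x : M) :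
    laplacian D f x =
      -(n : ℝ) * (Λ + α ^ 2 * ρ * ((n : ℝ) - 2) - q * scalarCurvature D x / 2
          - q * α ^ 2 * ((n : ℝ) - 1) ^ 2 / 2)
        - μ - ρ * (α ^ 2 + scalarCurvature D x) := by
  have hdiv : metricTrace x (lieMetric D' A.ξ x) = 2 * laplacian D f x := by
    rw [metricTrace_lieMetric, hD'.divergence_ξ hD, laplacian, hξ]
  rcases hsol with h | h
  · have hstar : A.starScalar D' x = scalarCurvature D x + α ^ 2 * ((n : ℝ) - 1) ^ 2 := by
      rw [← hA.starScalar_eq hD]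
      exact congrArg (metricTrace x) (funext₂ fun u v ↦ hD'.starRicci_eq u v hA hD)
    have tr := congrArg (metricTrace x) (funext₂ (h x))
    rw [metricTrace_add, metricTrace_add, metricTrace_add, metricTrace_mul, metricTrace_mul,
      metricTrace_mul, metricTrace_inner, A.metricTrace_η_mul_η] at tr
    change _ + _ * A.starScalar D' x + _ + _ = ∑ _, (0 : ℝ) at tr
    rw [Finset.sum_const_zero, hstar] at tr
    change metricTrace x (lieMetric D' A.ξ x) + _ + _ + _ = _ at tr
    linear_combination (1 / 2) * tr - (1 / 2) * hdiv
  · have tr := congrArg (metricTrace x) (funext₂ (h x))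
    rw [metricTrace_add, metricTrace_add, metricTrace_add, metricTrace_mul, metricTrace_mul,
      metricTrace_mul, metricTrace_inner, A.metricTrace_η_mul_η] at tr
    change _ + _ * scalarCurvature D' x + _ + _ = ∑ _, (0 : ℝ) at tr
    rw [Finset.sum_const_zero, hD'.scalarCurvature_eq hA hD] at tr
    change metricTrace x (lieMetric D' A.ξ x) + _ + _ + _ = _ at tr
    linear_combination (1 / 2) * tr - (1 / 2) * hdiv
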